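/- **Shelf shuffle.** Let $m\ge 1$ and $n\ge 0$ be integers. A shelf shuffler with $m$ shelves takes a deck of $n$ cards in the order $1,2,\dots,n$ (top to bottom) and deals its cards one at a time from the bottom. Each card is put on a uniformly chosen one of the $m$ shelves, on the top or on the bottom of the pile already lying there with probability $1/2$ each, all choices being independent. The piles are then unloaded, in the order of the shelves, into one deck. The shuffle produces the permutation $w\in S_n$ for which $w(i)$ is the card in position $i$ of the final deck. For $i\ge1$ let $N_i(w)$ be the number of $i$-cycles of a permutation $w$ (fixed points are $1$-cycles), and put $$f_{i,m}=\frac1{2i}\sum_{\substack{d\mid i\\ d\ \mathrm{odd}}}\mu(d)\,(2m)^{i/d},$$ where $\mu$ is the Möbius function. A random variable $X$ is Binomial$(f,p)$ if $\mathbb P(X=j)=\binom fj p^j(1-p)^{f-j}$ for $0\le j\le f$, and negative binomial with parameters $(f,p)$ if $\mathbb P(X=j)=\binom{f+j-1}{j}p^j(1-p)^f$ for $j=0,1,2,\dots$. **Corollary.** Let $m\ge1$. The numbers $f_{i,m}$, $i\ge 1$, are nonnegative integers, and the following hold. 1. Let $0<u<1$. Choose a random number $N$ of cards with $\mathbb P(N=n)=(1-u)u^n$,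 $n\ge0$, and, given $N$, let $w\in S_N$ be produced by a shelf shuffler with $m$ shelves and $N$ cards. Then any finite number of the random variables $N_i(w)$, $i\ge1$, are independent, and for every $i\ge 1$ the law of $N_i(w)$ is the convolution of a Binomial$\left(f_{i,m},\frac{(u/2m)^i}{1+(u/2m)^i}\right)$ law and a negative binomial law with parameters $\left(f_{i,m},(u/2m)^i\right)$. 2. Let $w_n\in S_n$ be produced by a shelf shuffler with $m$ shelves and $n$ cards. Then, as $n\to\infty$ with $m$ fixed, any finite number of the $N_i$ are asymptotically independent with the following limit laws. For every finite set $S$ of positive integers, $(N_i(w_n))_{i\in S}$ converges in distribution to $(Z_i)_{i\in S}$, that is, $\mathbb P\big((N_i(w_n))_{i\in S}\in A\big)\to\mathbb P\big((Z_i)_{i\in S}\in A\big)$ for every $A\subseteq\{0,1,2,\dots\}^S$. Here the $Z_i$ are independent, and the law of $Z_i$ is the convolution of a Binomial$\left(f_{i,m},\frac1{(2m)^i+1}\right)$ law and a negative binomial law with parameters $\left(f_{i,m},(1/2m)^i\right)$. -/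

import Mathlib

open MeasureTheory ProbabilityTheory

namespace ShelfShuffle

/-! ### The shelf shuffler -/

/-- The shelves after one more card `c` has been put on shelf `s`, on top of the pile lying there
if `onTop = true` and below it otherwise. A pile is the list of its cards from top to bottom. -/
def placeCard {n m : ℕ} (piles : Fin m → List (Fin n)) (s : Fin m) (onTop : Bool) (c : Fin n) :
    Fin m → List (Fin n) :=
  Function.update piles s (if onTop then c :: piles s else piles s ++ [c])

/-- The shelves after the cards of the list `l` have been dealt from the bottom of `l` (its last
entry) upwards. The pair `ω c` is the choice made for card `c`: its shelf, and whether the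
card goes on top (`true`) or to the bottom (`false`) of the pile. -/
def dealShelves {n m : ℕ} (ω : Fin n → Fin m × Bool) (l : List (Fin n)) : Fin m → List (Fin n) :=
  l.foldr (fun c piles => placeCard piles (ω c).1 (ω c).2 c) (fun _ => [])

/-- The final deck, from top to bottom: the ordered deck `0, 1, …, n - 1` is dealt to the `m`
shelves, and the piles are then unloaded in the order of the shelves. -/
def finalDeck {n m : ℕ} (ω : Fin n → Fin m × Bool) : List (Fin n) :=
  (List.finRange m).flatMap (dealShelves ω (List.finRange n))

/-- A pile consists of the cards put on top, in their original order, followed by the cards put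
to the bottom, in reversed order. -/
lemma dealShelves_eq {n m : ℕ} (ω : Fin n → Fin m × Bool) (l : List (Fin n)) (s : Fin m) :
    dealShelves ω l s =
      l.filter (fun c => ω c = (s, true)) ++ (l.filter (fun c => ω c = (s, false))).reverse := by
  induction l with
  | nil => simp [dealShelves]
  | cons c l ih =>
    have h : dealShelves ω (c :: l) = placeCard (dealShelves ω l) (ω c).1 (ω c).2 c := rfl
    rw [h]
    rcases hc : ω c with ⟨t, b⟩
    by_cases hts : s = t
    · subst hts
      cases b <;> simp [placeCard, ih, hc]
    · have hts' : ¬ t = s := fun h => hts h.symm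
      simp [placeCard, Function.update_of_ne hts, ih, hc, hts']

lemma mem_dealShelves {n m : ℕ} (ω : Fin n → Fin m × Bool) (s : Fin m) (c : Fin n) :
    c ∈ dealShelves ω (List.finRange n) s ↔ (ω c).1 = s := by
  rw [dealShelves_eq]
  rcases hc : ω c with ⟨t, b⟩
  cases b <;> simp [hc]

lemma mem_finalDeck {n m : ℕ} (ω : Fin n → Fin m × Bool) (c : Fin n) : c ∈ finalDeck ω := by
  simp [finalDeck, mem_dealShelves]

lemma nodup_finalDeck {n m : ℕ} (ω : Fin n → Fin m × Bool) : (finalDeck ω).Nodup := by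
  rw [finalDeck, List.nodup_flatMap]
  refine ⟨fun s _ => ?_, (List.nodup_finRange m).imp ?_⟩
  · rw [dealShelves_eq, List.nodup_append]
    refine ⟨(List.nodup_finRange n).filter _,
      List.nodup_reverse.2 ((List.nodup_finRange n).filter _), ?_⟩
    intro a ha b hb hab
    subst hab
    simp at ha hb
    simp [ha] at hb
  · intro s t hst c hs ht
    exact hst (((mem_dealShelves ω s c).1 hs).symm.trans ((mem_dealShelves ω t c).1 ht))

lemma length_finalDeck {n m : ℕ} (ω : Fin n → Fin m × Bool) : (finalDeck ω).length = n := by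
  have h := Fintype.card_congr
    ((nodup_finalDeck ω).getEquivOfForallMemList _ (mem_finalDeck ω))
  simpa using h

/-- The permutation produced by the shuffler: `shelfPerm ω i` is the card in position `i` (counted
from the top) of the final deck. -/
def shelfPerm {n m : ℕ} (ω : Fin n → Fin m × Bool) : Equiv.Perm (Fin n) :=
  (finCongr (length_finalDeck ω).symm).trans
    ((nodup_finalDeck ω).getEquivOfForallMemList _ (mem_finalDeck ω))

/-- Every set of permutations is an event. -/
instance instMeasurableSpacePerm (n : ℕ) : MeasurableSpace (Equiv.Perm (Fin n)) := ⊤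

/-- The law of the permutation of `n` cards produced by a shelf shuffler with `m` shelves: each card
chooses one of the `m` shelves and one of the two sides of the pile, all `(2m)^n` choices being
equally likely. -/
noncomputable def shelfShuffle (m n : ℕ) : Measure (Equiv.Perm (Fin n)) :=
  (uniformOn (Set.univ : Set (Fin n → Fin m × Bool))).map shelfPerm

/-- A real number as a point of `[0, 1]`. It is used for numbers in `[0, 1]` only (others are
moved to the nearer endpoint). -/
noncomputable def toProb (x : ℝ) : unitInterval := Set.projIcc 0 1 zero_le_one x

/-- The law of the pair `⟨N, w⟩`, where the number of cards `N` is random with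
`ℙ(N = n) = (1 - u) u ^ n` and, given `N`, the permutation `w` of `N` cards is produced by a shelf
shuffler with `m` shelves. -/
noncomputable def randomDeckShuffle (m : ℕ) (u : ℝ) : Measure (Σ n : ℕ, Equiv.Perm (Fin n)) :=
  (geometricMeasure (toProb (1 - u))).bind fun n => (shelfShuffle m n).map (Sigma.mk n)

/-! ### Cycle counts and the limiting laws -/

/-- The number of `i`-cycles of `w`; fixed points count as `1`-cycles. -/
def cycleCount (i : ℕ) {n : ℕ} (w : Equiv.Perm (Fin n)) : ℕ := w.partition.parts.count i

/-- `f_{i,m} = (1 / 2i) ∑_{d ∣ i, d odd} μ(d) (2m)^{i/d}`. -/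
def cycleExponent (i m : ℕ) : ℚ :=
  1 / (2 * i) *
    ∑ d ∈ i.divisors with Odd d, (ArithmeticFunction.moebius d : ℚ) * (2 * m) ^ (i / d)

/-- The negative binomial law with parameters `(f, p)`, `0 ≤ p < 1`: it gives `j = 0, 1, 2, …` the
mass `(f + j - 1 choose j) p ^ j (1 - p) ^ f`; for `f = 0` this is the point mass at `0`. -/
noncomputable def negativeBinomial (f : ℕ) (p : unitInterval) : Measure ℕ :=
  Measure.sum fun j : ℕ =>
    ENNReal.ofReal (((f + j - 1).choose j : ℝ) * (p : ℝ) ^ j * (1 - (p : ℝ)) ^ f) •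
      Measure.dirac j

end ShelfShuffle

open ShelfShuffle

/-! A shelf shuffle sorts a signed word. Card `c` carries the letter `ω c` (its shelf and side). The
final deck lists the cards by the rank of their letters; cards with equal letters keep their order
if the letter is positive (top) and are reversed if it is negative (bottom). This is
`isSorting_shelfPerm`; from there on any finite alphabet whose signs sum to zero will do.

Iterating the sorting permutation `w` from a position, one reads a periodic sequence of letters, its
itinerary, and the positions are ordered compatibly with the signed lexicographic order of the
itineraries. The number of positions with a given itinerary depends only on its necklace, i.e. its
class under rotation. As in the Gessel–Reutenauer bijection, words of length `n` correspond to
families of multiplicities of primitive necklaces of total length `n` (`multiplicity_injective`,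
`exists_multiplicity_eq`).

If `k` positions share an itinerary of minimal period `p`, then `w^p` permutes them, monotonically
or antitonically according to the product of the signs over a period. So a positive necklace yields
`k` cycles of length `p`, and a negative one `k % 2` cycles of length `p` and `k / 2` of length `2p`
(`card_fiber_minimalPeriod`). The cycle index is therefore a product of factors `1 / (1 - x_p X^p)`
and `(1 + x_p X^p) / (1 - x_{2p} X^{2p})`.

Because the signs sum to zero, the positive necklaces of length `i` and the negative ones of length
`i / 2` are together as many as the negative ones of length `i` (`necklaceCount_one`). The latter
number is `f_i = f_{i,m}`, by Möbius inversion over odd divisors. The product collapses to `∏ ((1 +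
x_i X^i) / (1 - x_i X^i))^{f_i}`, which is `1 / (1 - 2mX)` when all `x_i = 1`. Dividing, the
generating function for the lengths in a finite set `S` is `1 / (1 - 2mX)` times the product over
`S` of `((1 + x_i X^i)(1 - X^i) / ((1 - x_i X^i)(1 + X^i)))^{f_i}` (`jointGenFun_identity`).

At `X = u / 2m`, after multiplication by `1 - u`, this is a product of generating functions of
binomial and negative binomial laws. For the limit one multiplies by `1 - 2mX` and evaluates at `X =
1 / 2m`, where the partial sums telescope to the probabilities. Both computations concern point
masses; Fatou's lemma passes to arbitrary events. -/

namespace ShelfShuffle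

/-! ### Signed words and their sorting permutations -/

section SignedWords

variable {α : Type*} (κ : α → ℤ) (ε : α → ℤˣ)

/-- The shift of a sequence. -/
def shift (x : ℕ → α) : ℕ → α := fun j => x (j + 1)

lemma iterate_shift_apply (x : ℕ → α) (k j : ℕ) : (shift^[k] x) j = x (j + k) := by
  induction k generalizing j with
  | zero => rfl
  | succ k ih => rw [Function.iterate_succ_apply', shift, ih]; congr 1; omega

/-- The product of the signs of the first `k` letters. -/
def prefixSign (x : ℕ → α) (k : ℕ) : ℤˣ := ∏ j ∈ Finset.range k, ε (x j)

lemma prefixSign_succ' (x : ℕ → α) (k : ℕ) :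
    prefixSign ε x (k + 1) = ε (x 0) * prefixSign ε (shift x) k := by
  simp [prefixSign, Finset.prod_range_succ', shift, mul_comm]

lemma prefixSign_add (x : ℕ → α) (k l : ℕ) :
    prefixSign ε x (k + l) = prefixSign ε x k * prefixSign ε (shift^[k] x) l := by
  simp [prefixSign, Finset.prod_range_add, iterate_shift_apply, add_comm]

/-- The sequence of integers whose lexicographic order is the signed lexicographic order. -/
def signedCode (x : ℕ → α) : Lex (ℕ → ℤ) := toLex fun j => (prefixSign ε x j : ℤ) * κ (x j)

lemma lex_lt_iff_cons (f g : ℕ → ℤ) :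
    toLex f < toLex g ↔ f 0 < g 0 ∨ f 0 = g 0 ∧
      toLex (fun j => f (j + 1)) < toLex (fun j => g (j + 1)) := by
  constructor
  · rintro ⟨j, hj, hlt⟩
    rcases j with _ | j
    · exact Or.inl hlt
    · exact Or.inr ⟨hj 0 (Nat.succ_pos _), j, fun i hi => hj (i + 1) (by simpa using hi), hlt⟩
  · rintro (h | ⟨h0, j, hj, hlt⟩)
    · exact ⟨0, fun i hi => absurd hi (Nat.not_lt_zero _), h⟩
    · refine ⟨j + 1, fun i hi => ?_, hlt⟩
      rcases i with _ | i
      · exact h0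
      · exact hj i (by simpa using hi)

lemma lex_neg_lt_iff (f g : ℕ → ℤ) :
    toLex (fun j => -f j) < toLex (fun j => -g j) ↔ toLex g < toLex f := by
  constructor
  · rintro ⟨j, hj, hlt⟩
    exact ⟨j, fun i hi => (neg_injective (hj i hi)).symm, neg_lt_neg_iff.1 hlt⟩
  · rintro ⟨j, hj, hlt⟩
    exact ⟨j, fun i hi => congrArg Neg.neg (hj i hi).symm, neg_lt_neg hlt⟩

variable {κ} in
-- The sign in front of a letter involves earlier letters only, so the letters are recovered one
-- after the other.
lemma signedCode_injective (hκ : Function.Injective κ) :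
    Function.Injective (signedCode κ ε) := by
  intro x y h
  have h' : ∀ j, (prefixSign ε x j : ℤ) * κ (x j) = (prefixSign ε y j : ℤ) * κ (y j) :=
    fun j => congrFun (toLex.injective h) j
  funext j
  induction j using Nat.strong_induction_on with
  | _ j ih =>
    have hp : prefixSign ε x j = prefixSign ε y j :=
      Finset.prod_congr rfl fun i hi => by rw [ih i (Finset.mem_range.1 hi)]
    have := h' j
    rw [hp] at this
    exact hκ (mul_left_cancel₀ (Units.ne_zero _) this)

/-- Dropping the first letter changes all later prefix signs by the factor `ε (x 0)`. Hence a
negative first letter reverses the comparison of the tails. -/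
lemma signedCode_tail (x : ℕ → α) :
    (fun j => signedCode κ ε x (j + 1)) = fun j => (ε (x 0) : ℤ) * signedCode κ ε (shift x) j := by
  funext j
  show (prefixSign ε x (j + 1) : ℤ) * κ (x (j + 1)) =
    (ε (x 0) : ℤ) * ((prefixSign ε (shift x) j : ℤ) * κ (shift x j))
  rw [prefixSign_succ', Units.val_mul, mul_assoc]; rfl

lemma signedCode_lt_iff (x y : ℕ → α) :
    signedCode κ ε x < signedCode κ ε y ↔ κ (x 0) < κ (y 0) ∨ κ (x 0) = κ (y 0) ∧
      toLex (fun j => (ε (x 0) : ℤ) * signedCode κ ε (shift x) j) <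
        toLex (fun j => (ε (y 0) : ℤ) * signedCode κ ε (shift y) j) := by
  rw [← signedCode_tail, ← signedCode_tail]
  have h0 : ∀ z : ℕ → α, signedCode κ ε z 0 = κ (z 0) := fun z => by
    simp [signedCode, prefixSign]
  have h := lex_lt_iff_cons (signedCode κ ε x) (signedCode κ ε y)
  rw [h0, h0] at h
  exact h

lemma signedCode_lt_iff_of_pos {x y : ℕ → α} (h : x 0 = y 0) (hε : ε (x 0) = 1) :
    signedCode κ ε x < signedCode κ ε y ↔
      signedCode κ ε (shift x) < signedCode κ ε (shift y) := by
  rw [signedCode_lt_iff, ← h, hε]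
  simp
  rfl

lemma signedCode_lt_iff_of_neg {x y : ℕ → α} (h : x 0 = y 0) (hε : ε (x 0) = -1) :
    signedCode κ ε x < signedCode κ ε y ↔
      signedCode κ ε (shift y) < signedCode κ ε (shift x) := by
  rw [signedCode_lt_iff, ← h, hε]
  have hl := lex_neg_lt_iff (signedCode κ ε (shift x)) (signedCode κ ε (shift y))
  refine Iff.trans ?_ hl
  simp

variable {n : ℕ}

/-- The cards are sorted by their letters; cards with the same letter are in increasing order if
the letter is positive, in decreasing order if it is negative. -/
def letterKey (ω : Fin n → α) (c : Fin n) : ℤ ×ₗ ℤ := toLex (κ (ω c), (ε (ω c) : ℤ) * (c : ℕ))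

/-- The permutation `w` lists the cards in the order given by the signed word `ω`. -/
def IsSorting (ω : Fin n → α) (w : Equiv.Perm (Fin n)) : Prop :=
  StrictMono fun i => letterKey κ ε ω (w i)

variable {κ ε}

lemma IsSorting.unique {ω : Fin n → α} {w w' : Equiv.Perm (Fin n)} (h : IsSorting κ ε ω w)
    (h' : IsSorting κ ε ω w') : w = w' := by
  have := Tuple.unique_monotone (f := letterKey κ ε ω) (σ := w) (τ := w') h.monotone h'.monotone
  have hinj : Function.Injective (letterKey κ ε ω) := by
    have := h.injective
    intro a b hab
    have := @this (w.symm a) (w.symm b) (by simpa using hab)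
    exact w.symm.injective this
  ext i
  rw [hinj (congrFun this i)]

/-- The letters of the cards which one meets when one starts at position `c` and iterates `w`. -/
def itinerary (ω : Fin n → α) (w : Equiv.Perm (Fin n)) (c : Fin n) : ℕ → α :=
  fun j => ω (w^[j + 1] c)

lemma shift_itinerary (ω : Fin n → α) (w : Equiv.Perm (Fin n)) (c : Fin n) :
    shift (itinerary ω w c) = itinerary ω w (w c) := rfl

lemma iterate_shift_itinerary (ω : Fin n → α) (w : Equiv.Perm (Fin n)) (c : Fin n) (k : ℕ) :
    shift^[k] (itinerary ω w c) = itinerary ω w (w^[k] c) := by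
  induction k generalizing c with
  | zero => rfl
  | succ k ih => rw [Function.iterate_succ_apply, shift_itinerary, ih]; rfl

lemma IsSorting.lt_cases {ω : Fin n → α} {w : Equiv.Perm (Fin n)} (h : IsSorting κ ε ω w)
    {c d : Fin n} (hcd : c < d) :
    κ (ω (w c)) < κ (ω (w d)) ∨ κ (ω (w c)) = κ (ω (w d)) ∧
      (ε (ω (w c)) : ℤ) * (w c : ℕ) < (ε (ω (w d)) : ℤ) * (w d : ℕ) := by
  have := h hcd
  simpa [letterKey, Prod.Lex.toLex_lt_toLex] using this

lemma IsSorting.lt_iff_of_eq {ω : Fin n → α} {w : Equiv.Perm (Fin n)} (h : IsSorting κ ε ω w)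
    {c d : Fin n} (he : ω (w c) = ω (w d)) :
    c < d ↔ (ε (ω (w c)) : ℤ) * (w c : ℕ) < (ε (ω (w c)) : ℤ) * (w d : ℕ) := by
  rw [← h.lt_iff_lt]
  simp [letterKey, Prod.Lex.toLex_lt_toLex, he]

/-- Different first letters decide the comparison. If they agree, passing to `w c` and `w d` keeps
or exchanges the order of the positions exactly as it does that of the codes; this is repeated up to
an index where the itineraries differ. -/
lemma IsSorting.signedCode_lt (hκ : Function.Injective κ) {ω : Fin n → α}
    {w : Equiv.Perm (Fin n)} (h : IsSorting κ ε ω w) {c d : Fin n} (hcd : c < d)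
    (hne : itinerary ω w c ≠ itinerary ω w d) :
    signedCode κ ε (itinerary ω w c) < signedCode κ ε (itinerary ω w d) := by
  obtain ⟨j, hj⟩ := Function.ne_iff.1 hne
  clear hne
  induction j generalizing c d with
  | zero =>
    rw [signedCode_lt_iff]
    rcases h.lt_cases hcd with h1 | ⟨h1, -⟩
    · exact Or.inl h1
    · exact absurd (hκ h1) hj
  | succ j ih =>
    rcases h.lt_cases hcd with h1 | ⟨h1, h2⟩
    · rw [signedCode_lt_iff]; exact Or.inl h1
    · have h0 : itinerary ω w c 0 = itinerary ω w d 0 := hκ h1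
      rcases Int.units_eq_one_or (ε (itinerary ω w c 0)) with he | he
      · rw [signedCode_lt_iff_of_pos κ ε h0 he]
        have he' : ε (ω (w c)) = 1 := he
        rw [← hκ h1, he'] at h2
        exact ih (by simpa using h2) hj
      · rw [signedCode_lt_iff_of_neg κ ε h0 he]
        have he' : ε (ω (w c)) = -1 := he
        rw [← hκ h1, he'] at h2
        exact ih (by simpa using h2) (Ne.symm hj)

lemma IsSorting.signedCode_monotone (hκ : Function.Injective κ) {ω : Fin n → α}
    {w : Equiv.Perm (Fin n)} (h : IsSorting κ ε ω w) :
    Monotone fun c => signedCode κ ε (itinerary ω w c) := by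
  intro c d hcd
  rcases hcd.eq_or_lt with rfl | hlt
  · exact le_rfl
  · by_cases he : itinerary ω w c = itinerary ω w d
    · simp only [he]; exact le_rfl
    · exact (h.signedCode_lt hκ hlt he).le

/-- Applying `w` to two positions with the same next letter keeps their order if that letter is
positive and reverses it otherwise. The resulting cards are read again as positions, and the signs
multiply. -/
lemma IsSorting.lt_iff_iterate {ω : Fin n → α} {w : Equiv.Perm (Fin n)} (h : IsSorting κ ε ω w)
    {c d : Fin n} (he : itinerary ω w c = itinerary ω w d) (k : ℕ) :
    c < d ↔ (prefixSign ε (itinerary ω w c) k : ℤ) * (w^[k] c : Fin n) <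
      (prefixSign ε (itinerary ω w c) k : ℤ) * (w^[k] d : Fin n) := by
  induction k generalizing c d with
  | zero => simp [prefixSign]
  | succ k ih =>
    have h0 : ω (w c) = ω (w d) := congrFun he 0
    have h1 : itinerary ω w (w c) = itinerary ω w (w d) := congrArg shift he
    rw [h.lt_iff_of_eq h0, prefixSign_succ', shift_itinerary, Function.iterate_succ_apply,
      Function.iterate_succ_apply]
    have h2 := ih h1
    have h3 := ih h1.symm
    rw [← h1] at h3
    have h4 : ε (itinerary ω w c 0) = ε (ω (w c)) := rfl
    rw [h4]
    rcases Int.units_eq_one_or (ε (ω (w c))) with hs | hs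
    · rw [hs]; simpa using h2
    · rw [hs]; simpa using h3

end SignedWords

/-! ### Cycle counts and minimal periods -/

lemma minimalPeriod_eq_card_support_cycleOf {β : Type*} [Fintype β] [DecidableEq β]
    (w : Equiv.Perm β) {c : β} (hc : w c ≠ c) :
    Function.minimalPeriod w c = (w.cycleOf c).support.card := by
  have hcyc := Equiv.Perm.isCycle_cycleOf w hc
  rw [← hcyc.orderOf]
  have hc' : w.cycleOf c c ≠ c := by rwa [Equiv.Perm.cycleOf_apply_self]
  refine Nat.dvd_antisymm ?_ ?_
  · apply Function.IsPeriodicPt.minimalPeriod_dvd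
    have := Equiv.Perm.cycleOf_pow_apply_self w c (orderOf (w.cycleOf c))
    rw [pow_orderOf_eq_one] at this
    rw [Function.IsPeriodicPt, Function.IsFixedPt, ← Equiv.Perm.coe_pow]
    exact this.symm
  · rw [orderOf_dvd_iff_pow_eq_one, hcyc.pow_eq_one_iff' hc', Equiv.Perm.cycleOf_pow_apply_self,
      Equiv.Perm.coe_pow]
    exact Function.isPeriodicPt_minimalPeriod w c

/-- An `i`-cycle consists of `i` points of minimal period `i`. Counting points is what the fibres of
the itinerary map allow. -/
lemma mul_cycleCount {n : ℕ} (w : Equiv.Perm (Fin n)) {i : ℕ} (hi : 0 < i) :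
    i * cycleCount i w = {c | Function.minimalPeriod w c = i}.ncard := by
  classical
  rw [cycleCount, Equiv.Perm.parts_partition, Multiset.count_add, Multiset.count_replicate]
  -- `cycleType` leaves out the fixed points, which the partition adds as parts `1`; so `i = 1` is
  -- separate.
  rcases (Nat.succ_le_of_lt hi).eq_or_lt with h1 | h1
  · obtain rfl : i = 1 := h1.symm
    have h0 : w.cycleType.count 1 = 0 := Multiset.count_eq_zero.2 fun h =>
      absurd (Equiv.Perm.two_le_of_mem_cycleType h) (by norm_num)
    have : {c | Function.minimalPeriod w c = 1} = ((w.supportᶜ : Finset (Fin n)) : Set (Fin n)) := by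
      ext c
      simp [Function.minimalPeriod_eq_one_iff_isFixedPt, Function.IsFixedPt]
    rw [h0, this, Set.ncard_coe_finset, Finset.card_compl]
    simp
  · have hne : (1 : ℕ) ≠ i := by omega
    have hset : {c | Function.minimalPeriod w c = i} =
        (((w.cycleFactorsFinset.filter fun g => g.support.card = i).biUnion
          Equiv.Perm.support : Finset (Fin n)) : Set (Fin n)) := by
      ext c
      simp only [Set.mem_ofPred_eq, Finset.coe_biUnion, Finset.coe_filter, Set.mem_iUnion,
        Finset.mem_coe, exists_prop]
      constructor
      · intro h
        have hc : w c ≠ c := fun hf => by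
          have := Function.minimalPeriod_eq_one_iff_isFixedPt.2 (show Function.IsFixedPt w c from hf)
          omega
        exact ⟨w.cycleOf c, ⟨Equiv.Perm.cycleOf_mem_cycleFactorsFinset_iff.2
          (Equiv.Perm.mem_support.2 hc),
          (minimalPeriod_eq_card_support_cycleOf w hc).symm.trans h⟩,
          Equiv.Perm.mem_support_cycleOf_iff.2 ⟨Equiv.Perm.SameCycle.refl _ _,
            Equiv.Perm.mem_support.2 hc⟩⟩
      · rintro ⟨g, ⟨hg, hcard⟩, hcg⟩
        have hgc := Equiv.Perm.cycle_is_cycleOf hcg hg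
        have hc : w c ≠ c := Equiv.Perm.mem_support.1
          (Equiv.Perm.mem_cycleFactorsFinset_support_le hg hcg)
        rw [minimalPeriod_eq_card_support_cycleOf w hc, ← hgc, hcard]
    have hcount : w.cycleType.count i =
        (w.cycleFactorsFinset.filter fun g => g.support.card = i).card := by
      rw [Equiv.Perm.cycleType_def, Multiset.count_map]
      simp only [Function.comp_apply, eq_comm (a := i)]
      rfl
    rw [hset, Set.ncard_coe_finset, Finset.card_biUnion]
    · rw [Finset.sum_congr rfl fun g hg => (Finset.mem_filter.1 hg).2, hcount]
      simp [hne, mul_comm]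
    · intro g hg g' hg' hgg
      exact ((Equiv.Perm.cycleFactorsFinset_pairwise_disjoint w)
        (Finset.mem_filter.1 hg).1 (Finset.mem_filter.1 hg').1 hgg).disjoint_support

/-! ### Periodic sequences and necklaces -/

section Necklaces

variable {α : Type*}

lemma apply_mod_minimalPeriod_shift (x : ℕ → α) (j : ℕ) :
    x (j % Function.minimalPeriod shift x) = x j := by
  have := congrFun (Function.iterate_mod_minimalPeriod_eq (f := shift) (x := x) (n := j)) 0
  simpa [iterate_shift_apply] using this

/-- The sequences which are periodic under the shift with minimal period at most `N`. -/
abbrev PeriodicSeq (α : Type*) (N : ℕ) : Type _ :=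
  {x : ℕ → α // 0 < Function.minimalPeriod shift x ∧ Function.minimalPeriod shift x ≤ N}

/-- A sequence is determined by its minimal period and its first `N` letters. -/
instance (N : ℕ) [Finite α] : Finite (PeriodicSeq α N) := by
  let F : PeriodicSeq α N → Fin (N + 1) × (Fin N → α) := fun x =>
    (⟨Function.minimalPeriod shift x.1, Nat.lt_succ_of_le x.2.2⟩, fun j => x.1 j)
  refine Finite.of_injective F fun x y h => Subtype.ext (funext fun j => ?_)
  have h1 : Function.minimalPeriod shift x.1 = Function.minimalPeriod shift y.1 :=
    congrArg (fun z => (z.1 : ℕ)) h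
  have hlt : j % Function.minimalPeriod shift x.1 < N :=
    (Nat.mod_lt _ x.2.1).trans_le x.2.2
  have h2 := congrFun (congrArg Prod.snd h) ⟨_, hlt⟩
  rw [← apply_mod_minimalPeriod_shift x.1 j, ← apply_mod_minimalPeriod_shift y.1 j, ← h1]
  exact h2

lemma minimalPeriod_shift_shift {x : ℕ → α} (hx : 0 < Function.minimalPeriod shift x) :
    Function.minimalPeriod shift (shift x) = Function.minimalPeriod shift x :=
  Function.minimalPeriod_apply (Function.minimalPeriod_pos_iff_mem_periodicPts.1 hx)

/-- Rotation removes the letter `x 0` at the front of the period and appends the same letter at the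
end. -/
lemma prefixSign_minimalPeriod_shift (ε : α → ℤˣ) {x : ℕ → α} (hx : 0 < Function.minimalPeriod shift x) :
    prefixSign ε (shift x) (Function.minimalPeriod shift (shift x)) =
      prefixSign ε x (Function.minimalPeriod shift x) := by
  rw [minimalPeriod_shift_shift hx]
  have h1 := prefixSign_succ' ε x (Function.minimalPeriod shift x)
  have h2 : x (Function.minimalPeriod shift x) = x 0 := by
    rw [← apply_mod_minimalPeriod_shift x, Nat.mod_self]
  rw [prefixSign, Finset.prod_range_succ, h2, mul_comm] at h1
  exact (mul_left_cancel h1).symm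

variable [Finite α] {N : ℕ}

/-- The shift as a permutation of the periodic sequences of bounded period. -/
noncomputable def rotate (α : Type*) [Finite α] (N : ℕ) : Equiv.Perm (PeriodicSeq α N) :=
  Equiv.ofBijective
    (fun x => ⟨shift x.1, by rw [minimalPeriod_shift_shift x.2.1]; exact x.2⟩)
    (Finite.injective_iff_bijective.1 fun x y h => Subtype.ext <|
      (Function.bijOn_periodicPts shift).injOn
        (Function.minimalPeriod_pos_iff_mem_periodicPts.1 x.2.1)
        (Function.minimalPeriod_pos_iff_mem_periodicPts.1 y.2.1) (congrArg Subtype.val h))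

lemma coe_rotate (x : PeriodicSeq α N) : (rotate α N x : ℕ → α) = shift x.1 := rfl

lemma coe_rotate_pow (x : PeriodicSeq α N) (k : ℕ) :
    (((rotate α N) ^ k) x : ℕ → α) = shift^[k] x.1 := by
  induction k with
  | zero => rfl
  | succ k ih => rw [pow_succ', Equiv.Perm.mul_apply, coe_rotate, ih, Function.iterate_succ_apply']

/-- Necklaces: periodic sequences up to rotation. -/
abbrev Necklace (α : Type*) [Finite α] (N : ℕ) : Type _ :=
  Quotient (Equiv.Perm.SameCycle.setoid (rotate α N))

noncomputable instance : Fintype (PeriodicSeq α N) := Fintype.ofFinite _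

noncomputable instance : Fintype (Necklace α N) := Fintype.ofFinite _

lemma eq_of_sameCycle_rotate {γ : Type*} {φ : PeriodicSeq α N → γ}
    (hφ : ∀ x, φ (rotate α N x) = φ x) {x y : PeriodicSeq α N}
    (h : (rotate α N).SameCycle x y) : φ x = φ y := by
  obtain ⟨k, -, rfl⟩ := h.exists_pow_eq'
  induction k with
  | zero => rfl
  | succ k ih =>
    rw [pow_succ', Equiv.Perm.mul_apply, hφ]
    exact ih ⟨k, by simp⟩

/-- The number of letters of a necklace. -/
noncomputable def Necklace.length : Necklace α N → ℕ :=
  Quotient.lift (fun x => Function.minimalPeriod shift x.1) fun _ _ h =>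
    eq_of_sameCycle_rotate (φ := fun x => Function.minimalPeriod shift x.1)
      (fun x => minimalPeriod_shift_shift x.2.1) h

lemma Necklace.length_mk (x : PeriodicSeq α N) :
    Necklace.length (⟦x⟧ : Necklace α N) = Function.minimalPeriod shift x.1 := rfl

lemma Necklace.length_pos (q : Necklace α N) : 0 < q.length := by
  induction q using Quotient.inductionOn with
  | _ x => exact x.2.1

lemma Necklace.length_le (q : Necklace α N) : q.length ≤ N := by
  induction q using Quotient.inductionOn with
  | _ x => exact x.2.2

variable (ε : α → ℤˣ)

/-- The product of the signs of the letters of a necklace. -/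
noncomputable def Necklace.sign : Necklace α N → ℤˣ :=
  Quotient.lift (fun x => prefixSign ε x.1 (Function.minimalPeriod shift x.1)) fun _ _ h =>
    eq_of_sameCycle_rotate
      (φ := fun x => prefixSign ε x.1 (Function.minimalPeriod shift x.1))
      (fun x => prefixSign_minimalPeriod_shift ε x.2.1) h

lemma Necklace.sign_mk (x : PeriodicSeq α N) :
    Necklace.sign ε (⟦x⟧ : Necklace α N) =
      prefixSign ε x.1 (Function.minimalPeriod shift x.1) := rfl

open Classical in
-- The first `p` shifts of a sequence of minimal period `p` are distinct and exhaust its rotations.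
lemma Necklace.card_fiber (q : Necklace α N) :
    (Finset.univ.filter fun x : PeriodicSeq α N => (⟦x⟧ : Necklace α N) = q).card = q.length := by
  induction q using Quotient.inductionOn with
  | _ x =>
    have : (Finset.univ.filter fun y : PeriodicSeq α N =>
        (⟦y⟧ : Necklace α N) = ⟦x⟧) =
        (Finset.range (Function.minimalPeriod shift x.1)).image fun k => (rotate α N ^ k) x := by
      ext y
      simp only [Finset.mem_filter, Finset.mem_univ, true_and, Finset.mem_image, Finset.mem_range]
      constructor
      · intro h
        have h' : (rotate α N).SameCycle x y := (Quotient.exact h).symm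
        obtain ⟨k, -, rfl⟩ := h'.exists_pow_eq'
        refine ⟨k % Function.minimalPeriod shift x.1, Nat.mod_lt _ x.2.1, Subtype.ext ?_⟩
        rw [coe_rotate_pow, coe_rotate_pow, Function.iterate_mod_minimalPeriod_eq]
      · rintro ⟨k, -, rfl⟩
        exact Quotient.sound (Equiv.Perm.SameCycle.symm ⟨k, by simp⟩)
    rw [this, Finset.card_image_of_injOn, Finset.card_range, Necklace.length_mk]
    intro k hk l hl h
    have h' := congrArg Subtype.val h
    simp only [coe_rotate_pow] at h'
    exact Function.iterate_injOn_Iio_minimalPeriod (by simpa using hk) (by simpa using hl) h'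

lemma sum_periodicSeq {M : Type*} [AddCommMonoid M] (φ : Necklace α N → M) :
    ∑ x : PeriodicSeq α N, φ ⟦x⟧ = ∑ q : Necklace α N, q.length • φ q := by
  classical
  rw [← Finset.sum_fiberwise (s := Finset.univ) (g := fun x : PeriodicSeq α N =>
    (⟦x⟧ : Necklace α N))]
  refine Finset.sum_congr rfl fun q _ => ?_
  rw [← Necklace.card_fiber q, ← Finset.sum_const]
  exact Finset.sum_congr rfl fun x hx => by rw [(Finset.mem_filter.1 hx).2]

end Necklaces

/-! ### The multiplicities of the necklaces of a signed word -/

section Multiplicities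

variable {α : Type*} [Finite α] {κ : α → ℤ} {ε : α → ℤˣ} {n N : ℕ}

omit [Finite α] in
lemma minimalPeriod_itinerary (ω : Fin n → α) (w : Equiv.Perm (Fin n)) (hn : n ≤ N) (c : Fin n) :
    0 < Function.minimalPeriod shift (itinerary ω w c) ∧
      Function.minimalPeriod shift (itinerary ω w c) ≤ N := by
  have hper : c ∈ Function.periodicPts w := by
    refine ⟨orderOf w, orderOf_pos w, ?_⟩
    rw [Function.IsPeriodicPt, Function.IsFixedPt, ← Equiv.Perm.coe_pow, pow_orderOf_eq_one]
    rfl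
  have hpos := Function.minimalPeriod_pos_of_mem_periodicPts hper
  have h : Function.IsPeriodicPt shift (Function.minimalPeriod w c) (itinerary ω w c) := by
    rw [Function.IsPeriodicPt, Function.IsFixedPt, iterate_shift_itinerary,
      (Function.isPeriodicPt_minimalPeriod w c).eq]
  refine ⟨h.minimalPeriod_pos hpos, (h.minimalPeriod_le hpos).trans
    ((Function.minimalPeriod_le_card).trans ?_)⟩
  simpa using hn

/-- The itinerary as a periodic sequence. -/
def itinerarySeq (hn : n ≤ N) (ω : Fin n → α) (w : Equiv.Perm (Fin n)) (c : Fin n) :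
    PeriodicSeq α N :=
  ⟨itinerary ω w c, minimalPeriod_itinerary ω w hn c⟩

lemma rotate_itinerarySeq (hn : n ≤ N) (ω : Fin n → α) (w : Equiv.Perm (Fin n)) (c : Fin n) :
    rotate α N (itinerarySeq hn ω w c) = itinerarySeq hn ω w (w c) := rfl

open Classical in
/-- The number of positions with a given itinerary, as a function on necklaces. -/
noncomputable def multiplicity (hn : n ≤ N) (ω : Fin n → α) (w : Equiv.Perm (Fin n)) :
    Necklace α N → ℕ :=
  Quotient.lift (fun x => (Finset.univ.filter fun c => itinerarySeq hn ω w c = x).card)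
    fun _ _ h => eq_of_sameCycle_rotate
      (φ := fun x => (Finset.univ.filter fun c => itinerarySeq hn ω w c = x).card)
      -- `w` maps the positions with itinerary `x` bijectively onto those whose itinerary is the
      -- rotation of `x`.
      (fun x => (Finset.card_equiv w fun c => by
        simp [← rotate_itinerarySeq]).symm) h

open Classical in
lemma multiplicity_mk (hn : n ≤ N) (ω : Fin n → α) (w : Equiv.Perm (Fin n))
    (x : PeriodicSeq α N) :
    multiplicity hn ω w ⟦x⟧ =
      (Finset.univ.filter fun c => itinerarySeq hn ω w c = x).card := rfl

lemma sum_length_mul_multiplicity (hn : n ≤ N) (ω : Fin n → α) (w : Equiv.Perm (Fin n)) :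
    ∑ q : Necklace α N, q.length * multiplicity hn ω w q = n := by
  classical
  have h := sum_periodicSeq (multiplicity hn ω w)
  simp only [smul_eq_mul] at h
  rw [← h]
  simp only [multiplicity_mk]
  rw [← Finset.card_eq_sum_card_fiberwise (fun _ _ => Finset.mem_coe.2 (Finset.mem_univ _))]
  simp

/-- A signed word is determined by the multiplicities of its necklaces. -/
lemma multiplicity_injective (hκ : Function.Injective κ) (hn : n ≤ N) {ω ω' : Fin n → α}
    {w w' : Equiv.Perm (Fin n)} (h : IsSorting κ ε ω w) (h' : IsSorting κ ε ω' w')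
    (he : multiplicity hn ω w = multiplicity hn ω' w') : ω = ω' := by
  classical
  -- Both lists of codes are monotone in the position and take every value equally often, so they
  -- agree position by position.
  have hcode : ∀ c, itinerary ω w c = itinerary ω' w' c := by
    have hfib : ∀ x : PeriodicSeq α N, Nonempty
        ({c // itinerarySeq hn ω w c = x} ≃ {c // itinerarySeq hn ω' w' c = x}) := by
      intro x
      refine ⟨Fintype.equivOfCardEq ?_⟩
      rw [Fintype.card_subtype, Fintype.card_subtype]
      exact congrFun he ⟦x⟧
    let σ : Equiv.Perm (Fin n) := Equiv.ofFiberEquiv fun x => (hfib x).some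
    have hσ : ∀ c, itinerary ω' w' (σ c) = itinerary ω w c := fun c =>
      congrArg Subtype.val (Equiv.ofFiberEquiv_map (fun x => (hfib x).some) c)
    have hm := Tuple.unique_monotone (f := fun c => signedCode κ ε (itinerary ω' w' c))
      (σ := σ) (τ := 1) (by
        have := h.signedCode_monotone hκ
        simp only [Function.comp_def, hσ]
        exact this) (by
        have := h'.signedCode_monotone hκ
        exact this)
    intro c
    rw [← hσ]
    exact signedCode_injective ε hκ (congrFun hm c)
  have hletter : ∀ c, ω (w c) = ω' (w' c) := fun c => congrFun (hcode c) 0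
  set π : Equiv.Perm (Fin n) := w'⁻¹ * w with hπ
  have hw'π : ∀ c, w' (π c) = w c := fun c => by simp [hπ]
  have hitin : ∀ c, itinerary ω w (π c) = itinerary ω w c := by
    intro c
    have h1 : itinerarySeq hn ω' w' (π c) = itinerarySeq hn ω w c := by
      apply (rotate α N).injective
      rw [rotate_itinerarySeq, rotate_itinerarySeq, hw'π]
      exact Subtype.ext (hcode _).symm
    rw [hcode]
    exact congrArg Subtype.val h1
  -- It remains to see that `w = w'`, i.e. that `π` is the identity; for a permutation of a finite
  -- chain monotonicity suffices. Within a class of equal itineraries both sortings use the same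
  -- sign; between classes the codes decide.
  have hmono : StrictMono π := by
    intro c d hcd
    by_cases heq : itinerary ω w c = itinerary ω w d
    · have h1 : ω (w c) = ω (w d) := congrFun heq 0
      have h2 : ω' (w' (π c)) = ω' (w' (π d)) := by
        rw [← hletter, ← hletter]
        exact congrFun ((hitin c).trans (heq.trans (hitin d).symm)) 0
      rw [h.lt_iff_of_eq h1] at hcd
      rw [h'.lt_iff_of_eq h2]
      have h3 : ω' (w' (π c)) = ω (w c) := by
        rw [← hletter]
        exact congrFun (hitin c) 0
      rw [h3, hw'π, hw'π]
      exact hcd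
    · have h1 := h.signedCode_lt hκ hcd heq
      rw [← hitin c, ← hitin d] at h1
      by_contra hle
      exact absurd (h.signedCode_monotone hκ (not_lt.1 hle)) (not_le.2 h1)
  have hπ1 : ∀ c, π c = c := fun c => le_antisymm hmono.apply_le hmono.le_apply
  have hww : ∀ c, w' c = w c := fun c => by rw [← hw'π c, hπ1]
  funext c
  have := hletter (w⁻¹ c)
  rw [hww] at this
  simpa using this

/-! ### Cycle counts in terms of the multiplicities -/

/-- The number of `i`-cycles of a sorting permutation which come from a necklace with `p` letters,
sign `s` and multiplicity `k`. -/
def cycleContribution (p : ℕ) (s : ℤˣ) (k i : ℕ) : ℕ :=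
  if s = 1 then (if p = i then k else 0)
  else (if p = i then k % 2 else 0) + (if 2 * p = i then k / 2 else 0)

/-- Two fixed points would contradict the reversal of order, and the other points come in pairs, so
the parity of `T` decides. -/
lemma card_filter_fixed_of_antitone (T : Finset (Fin n)) (g : Fin n → Fin n)
    (hg : ∀ c ∈ T, g c ∈ T) (hanti : ∀ c ∈ T, ∀ d ∈ T, c < d → g d < g c)
    (hinv : ∀ c ∈ T, g (g c) = c) :
    (T.filter fun c => g c = c).card = T.card % 2 := by
  have hle : (T.filter fun c => g c = c).card ≤ 1 := by
    refine Finset.card_le_one.2 fun c hc d hd => ?_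
    rw [Finset.mem_filter] at hc hd
    by_contra hne
    rcases lt_or_gt_of_ne hne with hlt | hlt
    · have := hanti c hc.1 d hd.1 hlt
      rw [hc.2, hd.2] at this
      exact absurd hlt (not_lt.2 this.le)
    · have := hanti d hd.1 c hc.1 hlt
      rw [hc.2, hd.2] at this
      exact absurd hlt (not_lt.2 this.le)
  have hz : ((T.filter fun c => ¬ g c = c).card : ZMod 2) = 0 := by
    rw [Finset.card_eq_sum_ones, Nat.cast_sum]
    refine Finset.sum_involution (fun c _ => g c) (fun _ _ => by decide) ?_ ?_ ?_
    · intro c hc _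
      exact (Finset.mem_filter.1 hc).2
    · intro c hc
      rw [Finset.mem_filter] at hc ⊢
      exact ⟨hg c hc.1, fun h => hc.2 (by rw [hinv c hc.1] at h; exact h.symm)⟩
    · intro c hc
      exact hinv c (Finset.mem_filter.1 hc).1
  have hd : 2 ∣ (T.filter fun c => ¬ g c = c).card := (ZMod.natCast_eq_zero_iff _ _).1 hz
  have := Finset.card_filter_add_card_filter_not (s := T) (fun c => g c = c)
  omega

/-- A strictly monotone self-map of a finite chain lies both above and below the identity. -/
lemma eq_of_strictMonoOn (T : Finset (Fin n)) (g : Fin n → Fin n)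
    (hg : ∀ c ∈ T, g c ∈ T) (hmono : ∀ c ∈ T, ∀ d ∈ T, c < d → g c < g d) :
    ∀ c ∈ T, g c = c := by
  intro c hc
  let G : T → T := fun c => ⟨g c.1, hg c.1 c.2⟩
  have hG : StrictMono G := fun c d hcd => hmono c.1 c.2 d.1 d.2 hcd
  exact congrArg Subtype.val
    (le_antisymm (hG.apply_le (x := ⟨c, hc⟩)) (hG.le_apply (x := ⟨c, hc⟩)))

open Classical in
-- `w^p` maps the positions `T` with itinerary `x` to themselves. For sign `1` it is monotone on
-- `T`, hence the identity there, and all cycles through `T` have length `p`. For sign `-1` it is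
-- antitone, its square is the identity, its fixed points lie on `p`-cycles and the other points on
-- `2p`-cycles. The factors `p` and `i` avoid division: a cycle of length `i` meets `T` in `i / p`
-- points.
lemma card_fiber_minimalPeriod (hn : n ≤ N) {ω : Fin n → α} {w : Equiv.Perm (Fin n)}
    (h : IsSorting κ ε ω w) (x : PeriodicSeq α N) (i : ℕ) :
    ((Finset.univ.filter fun c => itinerarySeq hn ω w c = x).filter
        fun c => Function.minimalPeriod w c = i).card * (Necklace.length (⟦x⟧ : Necklace α N)) =
      i * cycleContribution (Necklace.length (⟦x⟧ : Necklace α N)) (Necklace.sign ε ⟦x⟧)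
        (multiplicity hn ω w ⟦x⟧) i := by
  rw [multiplicity_mk, Necklace.length_mk, Necklace.sign_mk]
  set T := Finset.univ.filter fun c => itinerarySeq hn ω w c = x with hT
  set p := Function.minimalPeriod shift x.1 with hp
  have hp0 : 0 < p := x.2.1
  have hTx : ∀ c, c ∈ T ↔ itinerary ω w c = x.1 := fun c => by
    rw [hT, Finset.mem_filter, Subtype.ext_iff]
    simp [itinerarySeq]
  have hdvd : ∀ c ∈ T, p ∣ Function.minimalPeriod w c := by
    intro c hc
    apply Function.IsPeriodicPt.minimalPeriod_dvd
    rw [← (hTx c).1 hc, Function.IsPeriodicPt, Function.IsFixedPt, iterate_shift_itinerary,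
      (Function.isPeriodicPt_minimalPeriod w c).eq]
  have hmaps : ∀ c ∈ T, w^[p] c ∈ T := by
    intro c hc
    rw [hTx, ← iterate_shift_itinerary, (hTx c).1 hc]
    exact Function.isPeriodicPt_minimalPeriod shift x.1
  have hiter : ∀ c ∈ T, ∀ d ∈ T, c < d → (prefixSign ε x.1 p : ℤ) * (w^[p] c : Fin n) <
      (prefixSign ε x.1 p : ℤ) * (w^[p] d : Fin n) := by
    intro c hc d hd hcd
    have := (h.lt_iff_iterate (((hTx c).1 hc).trans ((hTx d).1 hd).symm) p).1 hcd
    rwa [(hTx c).1 hc] at this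
  rcases Int.units_eq_one_or (prefixSign ε x.1 p) with hs | hs
  · have hfix := eq_of_strictMonoOn T w^[p] hmaps fun c hc d hd hcd => by
      have := hiter c hc d hd hcd
      rw [hs] at this
      simpa using this
    have hmin : ∀ c ∈ T, Function.minimalPeriod w c = p := fun c hc =>
      Nat.dvd_antisymm (Function.IsPeriodicPt.minimalPeriod_dvd (hfix c hc)) (hdvd c hc)
    rw [hs, cycleContribution, if_pos rfl]
    rw [Finset.filter_congr (q := fun _ => p = i) (fun c hc => by rw [hmin c hc])]
    split_ifs with hpi
    · rw [Finset.filter_true_of_mem fun _ _ => hpi, hpi, mul_comm]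
    · rw [Finset.filter_false_of_mem fun _ _ => hpi]; simp
  · have hanti : ∀ c ∈ T, ∀ d ∈ T, c < d → w^[p] d < w^[p] c := fun c hc d hd hcd => by
      have := hiter c hc d hd hcd
      rw [hs] at this
      simpa using this
    have hinv := eq_of_strictMonoOn T (fun c => w^[p] (w^[p] c))
      (fun c hc => hmaps _ (hmaps c hc)) fun c hc d hd hcd =>
        hanti _ (hmaps d hd) _ (hmaps c hc) (hanti c hc d hd hcd)
    have hcard := card_filter_fixed_of_antitone T w^[p] hmaps hanti hinv
    have hmin1 : ∀ c ∈ T, (Function.minimalPeriod w c = p ↔ w^[p] c = c) := fun c hc =>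
      ⟨fun he => by rw [← he]; exact Function.isPeriodicPt_minimalPeriod w c,
        fun hf => Nat.dvd_antisymm (Function.IsPeriodicPt.minimalPeriod_dvd hf) (hdvd c hc)⟩
    have hmin2 : ∀ c ∈ T, (Function.minimalPeriod w c = 2 * p ↔ ¬ w^[p] c = c) := fun c hc => by
      rw [← hmin1 c hc]
      have h2 : Function.minimalPeriod w c ∣ 2 * p := by
        apply Function.IsPeriodicPt.minimalPeriod_dvd
        rw [Function.IsPeriodicPt, Function.IsFixedPt, two_mul, Function.iterate_add_apply]
        exact hinv c hc
      obtain ⟨a, ha⟩ := hdvd c hc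
      rw [ha, mul_comm 2 p] at h2
      have ha2 : a ∣ 2 := Nat.dvd_of_mul_dvd_mul_left hp0 h2
      rcases (Nat.dvd_prime Nat.prime_two).1 ha2 with rfl | rfl
      · rw [ha]; constructor
        · intro; omega
        · intro; omega
      · rw [ha]; constructor
        · intro; omega
        · intro; omega
    have hneg : ¬ ((-1 : ℤˣ) = 1) := by decide
    rw [hs, cycleContribution, if_neg hneg]
    have hsum := Finset.card_filter_add_card_filter_not (s := T) (fun c => w^[p] c = c)
    have hall : ∀ c ∈ T, Function.minimalPeriod w c = p ∨ Function.minimalPeriod w c = 2 * p :=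
      fun c hc => by
        by_cases hf : w^[p] c = c
        · exact Or.inl ((hmin1 c hc).2 hf)
        · exact Or.inr ((hmin2 c hc).2 hf)
    by_cases h1 : p = i
    · subst i
      rw [if_pos rfl, if_neg (by omega), Finset.filter_congr hmin1, hcard, add_zero, mul_comm]
    · by_cases h2 : 2 * p = i
      · subst i
        rw [if_neg h1, if_pos rfl, Finset.filter_congr hmin2, zero_add]
        rw [hcard] at hsum
        have h3 : (T.filter fun c => ¬ w^[p] c = c).card = 2 * (T.card / 2) := by omega
        rw [h3]
        ring
      · rw [if_neg h1, if_neg h2, Finset.filter_false_of_mem]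
        · simp
        · intro c hc he
          rcases hall c hc with h3 | h3 <;> omega

/-- The cycle counts of a sorting permutation in terms of the multiplicities of the necklaces. -/
lemma cycleCount_eq_sum (hn : n ≤ N) {ω : Fin n → α} {w : Equiv.Perm (Fin n)}
    (h : IsSorting κ ε ω w) {i : ℕ} (hi : 0 < i) :
    cycleCount i w = ∑ q : Necklace α N,
      cycleContribution q.length (q.sign ε) (multiplicity hn ω w q) i := by
  classical
  apply Nat.eq_of_mul_eq_mul_left hi
  rw [mul_cycleCount w hi, Finset.mul_sum]
  have h1 : {c | Function.minimalPeriod w c = i} =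
      ((Finset.univ.filter fun c => Function.minimalPeriod w c = i : Finset (Fin n)) :
        Set (Fin n)) := by
    ext c; simp
  rw [h1, Set.ncard_coe_finset, Finset.card_eq_sum_card_fiberwise (f := itinerarySeq hn ω w)
    (t := Finset.univ) (fun _ _ => Finset.mem_coe.2 (Finset.mem_univ _)),
    ← Finset.sum_fiberwise (s := Finset.univ) (g := fun x : PeriodicSeq α N =>
      (⟦x⟧ : Necklace α N))]
  refine Finset.sum_congr rfl fun (q : Necklace α N) _ => ?_
  have key : ∀ x : PeriodicSeq α N, (⟦x⟧ : Necklace α N) = q →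
      ((Finset.univ.filter fun c => Function.minimalPeriod w c = i).filter
        fun c => itinerarySeq hn ω w c = x).card * q.length =
        i * cycleContribution q.length (q.sign ε) (multiplicity hn ω w q) i := by
    rintro x rfl
    rw [Finset.filter_comm]
    exact card_fiber_minimalPeriod hn h x i
  -- The necklace has `q.length` rotations, and by `key` each contributes the same amount once
  -- multiplied by `q.length`.
  apply Nat.eq_of_mul_eq_mul_right q.length_pos
  rw [Finset.sum_mul, Finset.sum_congr rfl fun x hx => key x (Finset.mem_filter.1 hx).2,
    Finset.sum_const, Necklace.card_fiber, smul_eq_mul, mul_comm]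

end Multiplicities

/-! ### Reconstruction of a signed word from necklace multiplicities. -/

section Surjectivity

variable {α : Type*} [Finite α] {κ : α → ℤ} {ε : α → ℤˣ} {n N : ℕ}

lemma mk_rotate (x : PeriodicSeq α N) :
    (⟦rotate α N x⟧ : Necklace α N) = ⟦x⟧ :=
  Quotient.sound (Equiv.Perm.SameCycle.symm ⟨1, by simp⟩)

/-- Every family of multiplicities of total size `n` comes from a signed word of length `n`. -/
lemma exists_multiplicity_eq (hκ : Function.Injective κ) (ε : α → ℤˣ) (hn : n ≤ N)
    (K : Necklace α N → ℕ) (hK : ∑ q, q.length * K q = n) :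
    ∃ (ω : Fin n → α) (w : Equiv.Perm (Fin n)), IsSorting κ ε ω w ∧ multiplicity hn ω w = K := by
  classical
  -- The future positions: each periodic sequence in as many numbered copies as its necklace
  -- prescribes, ordered by code and then by copy number.
  let T : Type _ := {z : PeriodicSeq α N × ℕ // z.2 < K ⟦z.1⟧}
  let sigmaEquiv : (Σ x : PeriodicSeq α N, Fin (K ⟦x⟧)) ≃ T :=
    { toFun := fun z => ⟨(z.1, z.2), z.2.2⟩
      invFun := fun z => ⟨z.1.1, z.1.2, z.2⟩
      left_inv := fun _ => rfl
      right_inv := fun _ => rfl }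
  let : Fintype T := Fintype.ofEquiv _ sigmaEquiv
  have hcard : Fintype.card T = n := by
    rw [← Fintype.card_congr sigmaEquiv, Fintype.card_sigma]
    simp only [Fintype.card_fin]
    rw [sum_periodicSeq K]
    simpa using hK
  let key : T → Lex (ℕ → ℤ) ×ₗ ℕ := fun z => toLex (signedCode κ ε z.1.1.1, z.1.2)
  have hkey : Function.Injective key := by
    intro y z h
    have h' := toLex.injective h
    exact Subtype.ext (Prod.ext
      (Subtype.ext (signedCode_injective ε hκ (congrArg Prod.fst h')))
      (congrArg Prod.snd h' :))
  let : LinearOrder T := LinearOrder.lift' key hkey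
  have hlt : ∀ y z : T, y < z ↔ signedCode κ ε y.1.1.1 < signedCode κ ε z.1.1.1 ∨
      signedCode κ ε y.1.1.1 = signedCode κ ε z.1.1.1 ∧ y.1.2 < z.1.2 := fun y z => by
    have : y < z ↔ key y < key z := Iff.rfl
    rw [this, Prod.Lex.toLex_lt_toLex]
  let e : Fin n ≃o T := Fintype.orderIsoFinOfCardEq T hcard
  -- The future `w` rotates the sequence. It must preserve the order of copies at a positive first
  -- letter and reverse it at a negative one, so the copy number `r` becomes `K - 1 - r` in the
  -- latter case.
  let W : T → T := fun z => ⟨(rotate α N z.1.1,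
    if ε (z.1.1.1 0) = 1 then z.1.2 else K ⟦z.1.1⟧ - 1 - z.1.2), by
      have := z.2
      simp only [mk_rotate]
      split_ifs <;> omega⟩
  have hWinj : Function.Injective W := by
    intro y z h
    have h1 : y.1.1 = z.1.1 := (rotate α N).injective (congrArg (fun u : T => u.1.1) h)
    have h2 := congrArg (fun u : T => u.1.2) h
    simp only [W] at h2
    have hy := y.2
    have hz := z.2
    rw [h1] at h2 hy
    refine Subtype.ext (Prod.ext h1 ?_)
    split_ifs at h2
    · exact h2
    · omega
  let Wp : Equiv.Perm T := Equiv.ofBijective W (Finite.injective_iff_bijective.1 hWinj)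
  let w : Equiv.Perm (Fin n) := e.toEquiv.trans (Wp.trans e.symm.toEquiv)
  have hw : ∀ i, e (w i) = W (e i) := fun i => by
    show e (e.symm (W (e i))) = W (e i)
    rw [e.apply_symm_apply]
  have hwit : ∀ (k : ℕ) (i : Fin n), (e (w^[k] i)).1.1.1 = shift^[k] (e i).1.1.1 := by
    intro k i
    induction k with
    | zero => rfl
    | succ k ih =>
      rw [Function.iterate_succ_apply', Function.iterate_succ_apply', ← ih, hw]
      rfl
  -- The card `w i` gets the first letter of the sequence at position `i`, which makes that sequence
  -- the itinerary of `i`.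
  let ω : Fin n → α := fun c => (e (w.symm c)).1.1.1 0
  have hω : ∀ i, ω (w i) = (e i).1.1.1 0 := fun i => by simp [ω]
  have hitin : ∀ i, itinerary ω w i = (e i).1.1.1 := by
    intro i
    funext j
    rw [itinerary, Function.iterate_succ_apply', hω, hwit, iterate_shift_apply, zero_add]
  refine ⟨ω, w, ?_, ?_⟩
  · intro i j hij
    simp only [letterKey, hω, Prod.Lex.toLex_lt_toLex]
    have h1 := (hlt _ _).1 (e.lt_iff_lt.2 hij)
    have h2 : κ ((e i).1.1.1 0) < κ ((e j).1.1.1 0) ∨ κ ((e i).1.1.1 0) = κ ((e j).1.1.1 0) := by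
      rcases h1 with h1 | h1
      · rw [signedCode_lt_iff] at h1
        exact h1.imp_right fun h => h.1
      · exact Or.inr (by rw [signedCode_injective ε hκ h1.1])
    refine h2.imp_right fun h0 => ⟨h0, ?_⟩
    have h0' : (e i).1.1.1 0 = (e j).1.1.1 0 := hκ h0
    have hlt' := fun a b : Fin n => (e.lt_iff_lt (x := a) (y := b)).symm.trans (hlt (e a) (e b))
    rcases Int.units_eq_one_or (ε ((e i).1.1.1 0)) with hs | hs
    · rw [← h0', hs]
      suffices w i < w j by simpa using this
      rw [hlt', hw, hw]
      simp only [W, coe_rotate]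
      rw [← h0', hs, if_pos rfl, ← signedCode_lt_iff_of_pos κ ε h0' hs]
      refine h1.imp_right fun h => ⟨?_, h.2⟩
      rw [signedCode_injective ε hκ h.1]
    · have hneg : ¬ ((-1 : ℤˣ) = 1) := by decide
      rw [← h0', hs]
      suffices w j < w i by simpa using this
      rw [hlt', hw, hw]
      simp only [W, coe_rotate]
      rw [← h0', hs, if_neg hneg, if_neg hneg, ← signedCode_lt_iff_of_neg κ ε h0' hs]
      refine h1.imp_right fun h => ?_
      have h3 : (e i).1.1 = (e j).1.1 := Subtype.ext (signedCode_injective ε hκ h.1)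
      refine ⟨by rw [h3], ?_⟩
      have hj := (e j).2
      have := h.2
      rw [h3]
      omega
  · funext q
    induction q using Quotient.inductionOn with
    | _ x =>
      rw [multiplicity_mk]
      have h1 : ∀ c, itinerarySeq hn ω w c = x ↔ (e c).1.1 = x := fun c => by
        rw [Subtype.ext_iff, Subtype.ext_iff, ← hitin]; rfl
      simp only [h1]
      rw [← Finset.card_range (K ⟦x⟧)]
      refine Finset.card_bij (fun c _ => (e c).1.2) ?_ ?_ ?_
      · intro c hc
        rw [Finset.mem_range, ← (Finset.mem_filter.1 hc).2]
        exact (e c).2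
      · intro c hc d hd hcd
        exact e.injective (Subtype.ext (Prod.ext
          ((Finset.mem_filter.1 hc).2.trans (Finset.mem_filter.1 hd).2.symm) hcd))
      · intro r hr
        exact ⟨e.symm ⟨(x, r), Finset.mem_range.1 hr⟩, by simp, by simp⟩

end Surjectivity

/-! ### The shelf shuffle as a signed word -/

section Shelf

variable {m n : ℕ}

/-- The rank of a letter: the shelves in their order, on each shelf the top cards first. -/
def shelfRank (a : Fin m × Bool) : ℤ := 2 * (a.1 : ℕ) + if a.2 then 0 else 1

/-- Cards put on top keep their order, cards put to the bottom are reversed. -/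
def shelfSign (a : Fin m × Bool) : ℤˣ := if a.2 then 1 else -1

lemma shelfRank_injective : Function.Injective (shelfRank (m := m)) := by
  rintro ⟨s, b⟩ ⟨t, c⟩ h
  have h1 : (s : ℕ) = t ∧ b = c := by
    cases b <;> cases c <;> simp [shelfRank] at h ⊢ <;> omega
  exact Prod.ext (Fin.ext h1.1) h1.2

lemma pairwise_letterKey_dealShelves (ω : Fin n → Fin m × Bool) (s : Fin m) :
    (dealShelves ω (List.finRange n) s).Pairwise fun c d =>
      letterKey shelfRank shelfSign ω c < letterKey shelfRank shelfSign ω d := by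
  have hsort : (List.finRange n).Pairwise (· < ·) := List.pairwise_lt_finRange n
  rw [dealShelves_eq, List.pairwise_append, List.pairwise_reverse]
  refine ⟨?_, ?_, ?_⟩
  · refine (hsort.filter _).imp_of_mem fun {c d} hc hd hcd => ?_
    simp at hc hd
    simp [letterKey, Prod.Lex.toLex_lt_toLex, hc, hd, shelfSign, hcd]
  · refine (hsort.filter _).imp_of_mem fun {c d} hc hd hcd => ?_
    simp at hc hd
    simp [letterKey, Prod.Lex.toLex_lt_toLex, hc, hd, shelfSign, hcd]
  · intro c hc d hd
    simp at hc hd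
    simp [letterKey, Prod.Lex.toLex_lt_toLex, hc, hd, shelfRank]

lemma pairwise_letterKey_finalDeck (ω : Fin n → Fin m × Bool) :
    (finalDeck ω).Pairwise fun c d =>
      letterKey shelfRank shelfSign ω c < letterKey shelfRank shelfSign ω d := by
  rw [finalDeck, List.pairwise_flatMap]
  refine ⟨fun s _ => pairwise_letterKey_dealShelves ω s,
    (List.pairwise_lt_finRange m).imp fun {s t} hst c hc d hd => ?_⟩
  rw [mem_dealShelves] at hc hd
  have hst' : (s : ℕ) < t := hst
  rw [letterKey, letterKey, Prod.Lex.toLex_lt_toLex]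
  left
  simp only [shelfRank, hc, hd]
  split_ifs <;> omega

lemma isSorting_shelfPerm (ω : Fin n → Fin m × Bool) :
    IsSorting shelfRank shelfSign ω (shelfPerm ω) := by
  intro i j hij
  have h := List.pairwise_iff_getElem.1 (pairwise_letterKey_finalDeck ω) i j
    (by rw [length_finalDeck]; exact i.2) (by rw [length_finalDeck]; exact j.2) hij
  exact h

end Shelf

/-! ### Counting necklaces -/

section Counting

variable {α : Type*}

lemma prefixSign_mul (ε : α → ℤˣ) {x : ℕ → α} {p : ℕ} (hp : shift^[p] x = x) (k : ℕ) :
    prefixSign ε x (p * k) = prefixSign ε x p ^ k := by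
  induction k with
  | zero => simp [prefixSign]
  | succ k ih =>
    rw [Nat.mul_succ, add_comm, prefixSign_add, hp, ih, pow_succ']

/-- The number of sequences with minimal period `p` whose first `p` letters have sign `s`. -/
noncomputable def primitiveCount (ε : α → ℤˣ) (s : ℤˣ) (p : ℕ) : ℕ :=
  {x : ℕ → α | Function.minimalPeriod shift x = p ∧ prefixSign ε x p = s}.ncard

lemma card_filter_periodicSeq [Finite α] {N : ℕ} (ε : α → ℤˣ) (s : ℤˣ) {p : ℕ} (hp : 0 < p)
    (hpN : p ≤ N) :
    (Finset.univ.filter fun x : PeriodicSeq α N => Function.minimalPeriod shift x.1 = p ∧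
      prefixSign ε x.1 (Function.minimalPeriod shift x.1) = s).card = primitiveCount ε s p := by
  classical
  rw [primitiveCount, ← Set.ncard_coe_finset,
    ← Set.ncard_image_of_injective _ (Subtype.val_injective)]
  congr 1
  ext x
  simp only [Finset.coe_filter, Finset.mem_univ, true_and, Set.mem_image, Set.mem_ofPred_eq]
  constructor
  · rintro ⟨x, ⟨h1, h2⟩, rfl⟩
    exact ⟨h1, by rw [← h1]; exact h2⟩
  · rintro ⟨h1, h2⟩
    have h3 : prefixSign ε x (Function.minimalPeriod shift x) = s := by rw [h1]; exact h2
    exact ⟨⟨x, by omega⟩, ⟨h1, h3⟩, rfl⟩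

/-- The number of necklaces of length `p` and sign `s`. -/
lemma length_mul_card_necklace [Finite α] {N : ℕ} (ε : α → ℤˣ) (s : ℤˣ) {p : ℕ} (hp : 0 < p)
    (hpN : p ≤ N) :
    p * (Finset.univ.filter fun q : Necklace α N => q.length = p ∧ q.sign ε = s).card =
      primitiveCount ε s p := by
  rw [← card_filter_periodicSeq ε s hp hpN, Finset.card_filter, Finset.card_filter]
  refine Eq.trans ?_ (sum_periodicSeq fun q : Necklace α N =>
    if q.length = p ∧ q.sign ε = s then 1 else 0).symm
  rw [Finset.mul_sum]
  refine Finset.sum_congr rfl fun q _ => ?_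
  by_cases h : Necklace.length q = p ∧ Necklace.sign ε q = s
  · rw [if_pos h, h.1, smul_eq_mul]
  · rw [if_neg h]; simp

/-- The sequences whose minimal period divides `i` are the words of length `i` repeated forever; the
power on the right expands over these words. -/
lemma sum_prod_periodicSeq [Fintype α] (g : α → ℤ) {i : ℕ} (hi : 0 < i) :
    ∑ x : PeriodicSeq α i with Function.minimalPeriod shift x.1 ∣ i,
      ∏ j ∈ Finset.range i, g (x.1 j) = (∑ a, g a) ^ i := by
  classical
  have hshift : ∀ v : Fin i → α, shift^[i] (fun j => v ⟨j % i, Nat.mod_lt _ hi⟩) =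
      fun j => v ⟨j % i, Nat.mod_lt _ hi⟩ := fun v => by
    funext j
    rw [iterate_shift_apply]
    simp
  rw [Fintype.sum_pow]
  refine Finset.sum_bij' (fun x _ => fun j : Fin i => x.1 j)
    (fun v _ => ⟨fun j => v ⟨j % i, Nat.mod_lt _ hi⟩,
      Function.IsPeriodicPt.minimalPeriod_pos hi (hshift v),
      Function.IsPeriodicPt.minimalPeriod_le hi (hshift v)⟩) ?_ ?_ ?_ ?_ ?_
  · simp
  · intro v _
    simp only [Finset.mem_filter, Finset.mem_univ, true_and]
    exact Function.IsPeriodicPt.minimalPeriod_dvd (hshift v)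
  · intro x hx
    refine Subtype.ext (funext fun j => ?_)
    show x.1 (j % i) = x.1 j
    rw [← apply_mod_minimalPeriod_shift x.1 (j % i), ← apply_mod_minimalPeriod_shift x.1 j,
      Nat.mod_mod_of_dvd _ (Finset.mem_filter.1 hx).2]
  · intro v _
    funext j
    show v ⟨(j : ℕ) % i, _⟩ = v j
    congr 1
    exact Fin.ext (Nat.mod_eq_of_lt j.2)
  · intro x _
    rw [Finset.prod_range]

/-- Grouped by minimal period `e`: the first `i` letters are a primitive block repeated `i / e`
times, so their sign is the `i / e`-th power of the sign of the block. -/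
lemma sum_prefixSign_pow [Finite α] (ε : α → ℤˣ) (g : ℤˣ → ℤ) {i : ℕ} (hi : 0 < i) :
    ∑ x : PeriodicSeq α i with Function.minimalPeriod shift x.1 ∣ i, g (prefixSign ε x.1 i) =
      ∑ e ∈ i.divisors, (g 1 * (primitiveCount ε 1 e : ℤ) +
        g ((-1) ^ (i / e)) * (primitiveCount ε (-1) e : ℤ)) := by
  classical
  rw [← Finset.sum_fiberwise_of_maps_to (t := i.divisors)
    (g := fun x : PeriodicSeq α i => Function.minimalPeriod shift x.1)
    (fun x hx => Nat.mem_divisors.2 ⟨(Finset.mem_filter.1 hx).2, hi.ne'⟩)]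
  refine Finset.sum_congr rfl fun e he => ?_
  obtain ⟨⟨k, rfl⟩, -⟩ := Nat.mem_divisors.1 he
  have he0 : 0 < e := Nat.pos_of_mul_pos_right hi
  have hei : e ≤ e * k := Nat.le_of_dvd hi (dvd_mul_right e k)
  rw [Nat.mul_div_cancel_left _ he0, Finset.filter_filter]
  have hsplit : (Finset.univ.filter fun x : PeriodicSeq α (e * k) =>
      Function.minimalPeriod shift x.1 ∣ e * k ∧ Function.minimalPeriod shift x.1 = e) =
      (Finset.univ.filter fun x : PeriodicSeq α (e * k) => Function.minimalPeriod shift x.1 = e ∧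
        prefixSign ε x.1 (Function.minimalPeriod shift x.1) = 1) ∪
      (Finset.univ.filter fun x : PeriodicSeq α (e * k) => Function.minimalPeriod shift x.1 = e ∧
        prefixSign ε x.1 (Function.minimalPeriod shift x.1) = -1) := by
    ext x
    simp only [Finset.mem_filter, Finset.mem_union, Finset.mem_univ, true_and]
    constructor
    · rintro ⟨-, h⟩
      exact (Int.units_eq_one_or _).imp (fun h' => ⟨h, h'⟩) (fun h' => ⟨h, h'⟩)
    · rintro (⟨h, -⟩ | ⟨h, -⟩) <;> exact ⟨by rw [h]; exact dvd_mul_right _ _, h⟩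
  have hval : ∀ x : PeriodicSeq α (e * k), Function.minimalPeriod shift x.1 = e →
      prefixSign ε x.1 (e * k) =
        prefixSign ε x.1 (Function.minimalPeriod shift x.1) ^ k := fun x hx => by
    rw [← prefixSign_mul ε (Function.isPeriodicPt_minimalPeriod shift x.1), hx]
  rw [hsplit, Finset.sum_union]
  · rw [← card_filter_periodicSeq ε 1 he0 hei, ← card_filter_periodicSeq ε (-1) he0 hei]
    congr 1
    · rw [mul_comm (g _), ← nsmul_eq_mul, ← Finset.sum_const]
      refine Finset.sum_congr rfl fun x hx => ?_
      have hx' := (Finset.mem_filter.1 hx).2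
      rw [hval x hx'.1, hx'.2, one_pow]
    · rw [mul_comm (g _), ← nsmul_eq_mul, ← Finset.sum_const]
      refine Finset.sum_congr rfl fun x hx => ?_
      have hx' := (Finset.mem_filter.1 hx).2
      rw [hval x hx'.1, hx'.2]
  · rw [Finset.disjoint_filter]
    rintro x - ⟨-, h1⟩ ⟨-, h2⟩
    rw [h1] at h2
    exact absurd h2 (by decide)

variable [Fintype α] (ε : α → ℤˣ) (hε : ∑ a, (ε a : ℤ) = 0)

lemma sum_divisors_primitiveCount {i : ℕ} (hi : 0 < i) :
    ∑ e ∈ i.divisors, ((primitiveCount ε 1 e : ℤ) + primitiveCount ε (-1) e) =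
      (Fintype.card α : ℤ) ^ i := by
  have h1 := sum_prefixSign_pow ε (fun _ => 1) hi
  have h2 := sum_prod_periodicSeq (fun _ : α => (1 : ℤ)) hi
  simp only [Finset.prod_const_one, Finset.sum_const, Finset.card_univ, one_mul, nsmul_eq_mul,
    mul_one] at h1 h2
  rw [← h1, h2]

include hε in
-- The signs of all words of length `i` sum to `(∑ a, ε a) ^ i = 0`.
lemma sum_divisors_signed_primitiveCount {i : ℕ} (hi : 0 < i) :
    ∑ e ∈ i.divisors, ((primitiveCount ε 1 e : ℤ) + (-1) ^ (i / e) * primitiveCount ε (-1) e) =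
      0 := by
  have h1 := sum_prefixSign_pow ε (fun s => (s : ℤ)) hi
  have h2 := sum_prod_periodicSeq (fun a : α => (ε a : ℤ)) hi
  rw [hε, zero_pow hi.ne'] at h2
  simp only [prefixSign, Units.coe_prod] at h1
  rw [h2] at h1
  simpa using h1.symm

end Counting

/-! ### Numbers of positive and negative necklaces. -/

section NecklaceCount

variable {α : Type*} [Fintype α] {ε : α → ℤˣ}

lemma eq_zero_of_sum_divisors_eq_zero {D : ℕ → ℤ}
    (hD : ∀ i, 0 < i → ∑ e ∈ i.divisors, D e = 0) {i : ℕ} (hi : 0 < i) : D i = 0 := by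
  induction i using Nat.strong_induction_on with
  | _ i ih =>
    have h := hD i hi
    rw [← Nat.cons_self_properDivisors hi.ne', Finset.sum_cons, Finset.sum_eq_zero, add_zero] at h
    · exact h
    · intro e he
      obtain ⟨h1, h2⟩ := Nat.mem_properDivisors.1 he
      exact ih e h2 (Nat.pos_of_dvd_of_pos h1 hi)

lemma sum_divisors_even (g : ℕ → ℤ) {i : ℕ} (hi : 0 < i) :
    ∑ e ∈ i.divisors, (if Even e then g (e / 2) else 0) =
      ∑ e ∈ i.divisors, (if Even (i / e) then g e else 0) := by
  rw [← Finset.sum_filter, ← Finset.sum_filter]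
  refine Finset.sum_bij' (fun e _ => e / 2) (fun e _ => 2 * e) ?_ ?_ ?_ ?_ ?_
  · intro e he
    obtain ⟨he1, f, rfl⟩ := Finset.mem_filter.1 he
    obtain ⟨⟨k, rfl⟩, -⟩ := Nat.mem_divisors.1 he1
    have hf : 0 < f := by
      rcases Nat.eq_zero_or_pos f with rfl | h
      · simp at hi
      · exact h
    have h1 : (f + f) / 2 = f := by omega
    have h2 : (f + f) * k = f * (k + k) := by ring
    rw [h1, h2, Finset.mem_filter, Nat.mem_divisors, Nat.mul_div_cancel_left _ hf]
    exact ⟨⟨dvd_mul_right _ _, by rw [← h2]; exact hi.ne'⟩, k, rfl⟩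
  · intro e he
    obtain ⟨he1, f, hf⟩ := Finset.mem_filter.1 he
    obtain ⟨⟨k, rfl⟩, -⟩ := Nat.mem_divisors.1 he1
    rw [Nat.mul_div_cancel_left _ (Nat.pos_of_mul_pos_right hi)] at hf
    subst hf
    rw [Finset.mem_filter, Nat.mem_divisors]
    exact ⟨⟨⟨f, by ring⟩, hi.ne'⟩, even_two_mul e⟩
  · intro e he
    exact Nat.two_mul_div_two_of_even (Finset.mem_filter.1 he).2
  · intro e _
    simp
  · intro e _
    rfl

/-- Relation between the numbers of positive and negative primitive sequences. -/
lemma primitiveCount_one (hε : ∑ a, (ε a : ℤ) = 0) {i : ℕ} (hi : 0 < i) :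
    primitiveCount ε 1 i + (if Even i then 2 * primitiveCount ε (-1) (i / 2) else 0) =
      primitiveCount ε (-1) i := by
  -- In the divisor sum the last term becomes a sum over the `e` with `i / e` even, where it turns
  -- `-1` into `+1`. What remains is the signed sum, which vanishes.
  have h := eq_zero_of_sum_divisors_eq_zero (D := fun i => (primitiveCount ε 1 i : ℤ) -
    primitiveCount ε (-1) i + (if Even i then 2 * (primitiveCount ε (-1) (i / 2) : ℤ) else 0))
    (fun i hi => by
      rw [Finset.sum_add_distrib,
        sum_divisors_even (fun e => 2 * (primitiveCount ε (-1) e : ℤ)) hi,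
        ← Finset.sum_add_distrib]
      refine Eq.trans ?_ (sum_divisors_signed_primitiveCount ε hε hi)
      refine Finset.sum_congr rfl fun e _ => ?_
      split_ifs with he
      · rw [he.neg_one_pow]; ring
      · rw [(Nat.not_even_iff_odd.1 he).neg_one_pow]; ring) hi
  zify
  split_ifs at h ⊢
  · linarith
  · linarith

/-- The convolution inverse of the indicator of the odd numbers. -/
def oddMoebius : ArithmeticFunction ℤ :=
  ⟨fun d => if Odd d then ArithmeticFunction.moebius d else 0, by simp⟩

/-- The indicator of the odd numbers. -/
def oddZeta : ArithmeticFunction ℤ := ⟨fun d => if Odd d then 1 else 0, by simp⟩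

/-- A product is odd exactly when both factors are, so restriction to odd numbers respects Dirichlet
convolution. -/
lemma oddMoebius_mul_oddZeta : oddMoebius * oddZeta = 1 := by
  ext n
  rw [ArithmeticFunction.mul_apply]
  have h1 : ∀ x ∈ n.divisorsAntidiagonal, oddMoebius x.1 * oddZeta x.2 =
      if Odd n then ArithmeticFunction.moebius x.1 * (ArithmeticFunction.zeta x.2 : ℤ) else 0 := by
    intro x hx
    obtain ⟨rfl, h0⟩ := Nat.mem_divisorsAntidiagonal.1 hx
    have hx2 : x.2 ≠ 0 := right_ne_zero_of_mul h0
    simp only [oddMoebius, oddZeta, ArithmeticFunction.coe_mk, Nat.odd_mul,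
      ArithmeticFunction.zeta_apply, if_neg hx2]
    by_cases h1 : Odd x.1 <;> by_cases h2 : Odd x.2 <;> simp [h1, h2]
  rw [Finset.sum_congr rfl h1]
  by_cases hn : Odd n
  · simp only [hn, if_true]
    have := congrArg (fun f : ArithmeticFunction ℤ => f n)
      ArithmeticFunction.moebius_mul_coe_zeta
    simp only [ArithmeticFunction.mul_apply] at this
    simpa using this
  · simp only [hn, if_false, Finset.sum_const_zero]
    rw [ArithmeticFunction.one_apply_ne]
    rintro rfl
    exact hn odd_one

/-- The number of negative primitive sequences by Möbius inversion over odd divisors. -/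
lemma two_mul_primitiveCount_neg (hε : ∑ a, (ε a : ℤ) = 0) {i : ℕ} (hi : 0 < i) :
    2 * (primitiveCount ε (-1) i : ℤ) = ∑ d ∈ i.divisors with Odd d,
      ArithmeticFunction.moebius d * (Fintype.card α : ℤ) ^ (i / d) := by
  let V : ArithmeticFunction ℤ :=
    ⟨fun d => if d = 0 then 0 else 2 * (primitiveCount ε (-1) d : ℤ), by simp⟩
  let G : ArithmeticFunction ℤ :=
    ⟨fun d => if d = 0 then 0 else (Fintype.card α : ℤ) ^ d, by simp⟩
  -- Subtracting the signed divisor sum from the unsigned one cancels the positive sequences, and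
  -- the negative ones with `i / e` even.
  have hG : oddZeta * V = G := by
    ext n
    rcases Nat.eq_zero_or_pos n with rfl | hn
    · simp
    rw [ArithmeticFunction.mul_apply, Nat.sum_divisorsAntidiagonal' (fun a b => oddZeta a * V b)]
    have h1 := sum_divisors_primitiveCount ε hn
    have h2 := sum_divisors_signed_primitiveCount ε hε hn
    have h3 : G n = (Fintype.card α : ℤ) ^ n := if_neg hn.ne'
    rw [h3, ← sub_zero (_ ^ n), ← h2, ← h1, ← Finset.sum_sub_distrib]
    refine Finset.sum_congr rfl fun e he => ?_
    have he0 : e ≠ 0 := (Nat.pos_of_mem_divisors he).ne'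
    simp only [oddZeta, V, ArithmeticFunction.coe_mk, if_neg he0]
    split_ifs with ho
    · rw [ho.neg_one_pow]; ring
    · rw [(Nat.not_odd_iff_even.1 ho).neg_one_pow]; ring
  have hV : V = oddMoebius * G := by
    rw [← hG, ← mul_assoc, oddMoebius_mul_oddZeta, one_mul]
  have h := congrArg (fun f : ArithmeticFunction ℤ => f i) hV
  simp only [ArithmeticFunction.mul_apply] at h
  rw [Nat.sum_divisorsAntidiagonal (fun a b => oddMoebius a * G b)] at h
  have hVi : V i = 2 * (primitiveCount ε (-1) i : ℤ) := if_neg hi.ne'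
  rw [← hVi, h, Finset.sum_filter]
  refine Finset.sum_congr rfl fun d hd => ?_
  have hd' : i / d ≠ 0 :=
    (Nat.div_pos (Nat.divisor_le hd) (Nat.pos_of_mem_divisors hd)).ne'
  simp only [oddMoebius, G, ArithmeticFunction.coe_mk, if_neg hd']
  split_ifs <;> simp

variable (ε) in
/-- The number of necklaces of length `p` and sign `s`. -/
noncomputable def necklaceCount (s : ℤˣ) (p : ℕ) : ℕ := primitiveCount ε s p / p

/-- The division in `necklaceCount` is exact, and the count does not depend on the bound `N`. -/
lemma card_necklace {N : ℕ} (s : ℤˣ) {p : ℕ} (hp : 0 < p) (hpN : p ≤ N) :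
    (Finset.univ.filter fun q : Necklace α N => q.length = p ∧ q.sign ε = s).card =
      necklaceCount ε s p := by
  rw [necklaceCount, ← length_mul_card_necklace ε s hp hpN, Nat.mul_div_cancel_left _ hp]

lemma mul_necklaceCount (s : ℤˣ) {p : ℕ} (hp : 0 < p) :
    p * necklaceCount ε s p = primitiveCount ε s p := by
  rw [← card_necklace s hp le_rfl, length_mul_card_necklace ε s hp le_rfl]

/-- This balance gives the numerator and the denominator of the cycle index the same exponents. -/
lemma necklaceCount_one (hε : ∑ a, (ε a : ℤ) = 0) {i : ℕ} (hi : 0 < i) :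
    necklaceCount ε 1 i + (if Even i then necklaceCount ε (-1) (i / 2) else 0) =
      necklaceCount ε (-1) i := by
  have h := primitiveCount_one hε hi
  apply Nat.eq_of_mul_eq_mul_left hi
  rw [mul_add, mul_necklaceCount 1 hi, mul_necklaceCount (-1) hi, ← h]
  congr 1
  split_ifs with he
  · obtain ⟨f, rfl⟩ := he
    have h1 : (f + f) / 2 = f := by omega
    rw [h1, ← mul_necklaceCount (-1) (by omega : 0 < f)]
    ring
  · rfl

end NecklaceCount

/-! ### The exponents of the shelf alphabet. -/

section ShelfExponent

variable {m : ℕ}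

lemma sum_shelfSign : ∑ a : Fin m × Bool, (shelfSign a : ℤ) = 0 := by
  rw [Fintype.sum_prod_type]
  simp [shelfSign]

/-- The exponent `f_{i,m}` counts the necklaces of length `i` with an odd number of negative
letters. -/
lemma necklaceCount_eq_cycleExponent {i : ℕ} (hi : 0 < i) :
    (necklaceCount (shelfSign (m := m)) (-1) i : ℚ) = cycleExponent i m := by
  have h := two_mul_primitiveCount_neg (sum_shelfSign (m := m)) hi
  rw [← mul_necklaceCount (-1) hi] at h
  have h' := congrArg (Int.cast : ℤ → ℚ) h
  push_cast at h'
  rw [cycleExponent]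
  have hc : ((Fintype.card (Fin m × Bool) : ℕ) : ℚ) = 2 * m := by simp [mul_comm]
  rw [hc] at h'
  rw [← h']
  have : (i : ℚ) ≠ 0 := by exact_mod_cast hi.ne'
  field_simp

end ShelfExponent

/-! ### The cycle index of signed words -/

section CycleIndex

open PowerSeries

variable {R : Type*} [CommRing R]

/-- The power series `∑ k, y k * X ^ (p * k)`. -/
noncomputable def spread (p : ℕ) (y : ℕ → R) : R⟦X⟧ :=
  PowerSeries.mk fun l => if p ∣ l then y (l / p) else 0

lemma coeff_spread_mul {p : ℕ} (hp : 0 < p) (y : ℕ → R) (k : ℕ) :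
    coeff (p * k) (spread p y) = y k := by
  rw [spread, coeff_mk, if_pos (dvd_mul_right _ _), Nat.mul_div_cancel_left _ hp]

lemma coeff_spread_of_not_dvd {p l : ℕ} (h : ¬ p ∣ l) (y : ℕ → R) :
    coeff l (spread p y) = 0 := by
  rw [spread, coeff_mk, if_neg h]

lemma spread_eq_add {p : ℕ} (hp : 0 < p) (y : ℕ → R) :
    spread p y = C (y 0) + X ^ p * spread p (fun k => y (k + 1)) := by
  ext l
  rw [map_add, coeff_C, coeff_X_pow_mul']
  by_cases hl : p ∣ l
  · obtain ⟨k, rfl⟩ := hl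
    rw [coeff_spread_mul hp]
    rcases k with _ | k
    · simp [hp.ne']
    · have h1 : p ≤ p * (k + 1) := Nat.le_mul_of_pos_right _ (Nat.succ_pos _)
      have h2 : p * (k + 1) - p = p * k := by rw [Nat.mul_succ, Nat.add_sub_cancel]
      rw [if_neg (by positivity), if_pos h1, h2, coeff_spread_mul hp, zero_add]
  · rw [coeff_spread_of_not_dvd hl, if_neg (fun h : l = 0 => hl (h ▸ dvd_zero p)), zero_add]
    split_ifs with h
    · rw [coeff_spread_of_not_dvd]
      intro hd
      have := dvd_add hd (dvd_refl p)
      rw [Nat.sub_add_cancel h] at this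
      exact hl this
    · rfl

lemma spread_const_mul (p : ℕ) (a : R) (y : ℕ → R) :
    spread p (fun k => a * y k) = C a * spread p y := by
  ext l
  simp only [spread, coeff_mk, coeff_C_mul]
  split_ifs <;> simp

lemma spread_pow_mul {p : ℕ} (hp : 0 < p) (a : R) :
    spread p (fun k => a ^ k) * (1 - C a * X ^ p) = 1 := by
  have h := spread_eq_add hp (fun k => a ^ k)
  simp only [pow_succ', spread_const_mul, pow_zero, map_one] at h
  linear_combination h

/-- Raising the multiplicity by two multiplies the coefficient by `b`, so the series is geometric in
steps of `2p`, starting from `1 + a X^p`. -/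
lemma spread_alternating_mul {p : ℕ} (hp : 0 < p) (a b : R) :
    spread p (fun k => a ^ (k % 2) * b ^ (k / 2)) * (1 - C b * X ^ (2 * p)) =
      1 + C a * X ^ p := by
  have h := spread_eq_add hp (fun k => a ^ (k % 2) * b ^ (k / 2))
  have h' := spread_eq_add hp (fun k => a ^ ((k + 1) % 2) * b ^ ((k + 1) / 2))
  have h2 : (fun k : ℕ => a ^ ((k + 1 + 1) % 2) * b ^ ((k + 1 + 1) / 2)) =
      fun k => b * (a ^ (k % 2) * b ^ (k / 2)) := by
    funext k
    have h3 : (k + 1 + 1) % 2 = k % 2 := by omega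
    have h4 : (k + 1 + 1) / 2 = k / 2 + 1 := by omega
    rw [h3, h4, pow_succ]
    ring
  rw [h2, spread_const_mul] at h'
  simp only [Nat.zero_mod, Nat.zero_div, pow_zero, mul_one, map_one, zero_add, Nat.one_mod,
    pow_one, Nat.reduceDiv] at h h'
  rw [h'] at h
  rw [two_mul, pow_add]
  linear_combination h

variable {α : Type*} {κ : α → ℤ} {ε : α → ℤˣ} {n N : ℕ}

/-- The range reaches `2N` because a negative necklace of length `p ≤ N` may create cycles of length
`2p`. -/
lemma prod_pow_cycleContribution (x : ℕ → R) {p : ℕ} (hp : 0 < p) (hpN : p ≤ N) (s : ℤˣ)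
    (k : ℕ) :
    ∏ i ∈ Finset.Icc 1 (2 * N), x i ^ cycleContribution p s k i =
      if s = 1 then x p ^ k else x p ^ (k % 2) * x (2 * p) ^ (k / 2) := by
  have h1 : p ∈ Finset.Icc 1 (2 * N) := Finset.mem_Icc.2 (by omega)
  have h2 : 2 * p ∈ Finset.Icc 1 (2 * N) := Finset.mem_Icc.2 (by omega)
  have key : ∀ (r k : ℕ), r ∈ Finset.Icc 1 (2 * N) →
      ∏ i ∈ Finset.Icc 1 (2 * N), x i ^ (if r = i then k else 0) = x r ^ k := by
    intro r k hr
    simp only [pow_ite, pow_zero]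
    rw [Finset.prod_ite_eq, if_pos hr]
  unfold cycleContribution
  split_ifs with hs
  · exact key p k h1
  · simp only [pow_add]
    rw [Finset.prod_mul_distrib, key _ _ h1, key _ _ h2]

/-- The contribution of one necklace to the cycle index. -/
noncomputable def necklaceSeries (x : ℕ → R) (p : ℕ) (s : ℤˣ) : R⟦X⟧ :=
  spread p fun k => if s = 1 then x p ^ k else x p ^ (k % 2) * x (2 * p) ^ (k / 2)

/-- The bijection between words and multiplicities, as a generating function: a choice of exponents
`l q` in the product over necklaces is matched with the word of multiplicities `l q / q.length`. -/
lemma sum_prod_cycleCount_eq_coeff [Fintype α] (hκ : Function.Injective κ) (hn : n ≤ N)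
    (x : ℕ → R) (w : (Fin n → α) → Equiv.Perm (Fin n)) (hw : ∀ ω, IsSorting κ ε ω (w ω)) :
    ∑ ω, ∏ i ∈ Finset.Icc 1 (2 * N), x i ^ cycleCount i (w ω) =
      coeff n (∏ q : Necklace α N, necklaceSeries x q.length (q.sign ε)) := by
  classical
  rw [coeff_prod]
  refine Finset.sum_of_injOn
    (fun ω => Finsupp.equivFunOnFinite.symm fun q : Necklace α N =>
      q.length * multiplicity hn ω (w ω) q) ?_ ?_ ?_ ?_
  · intro ω _ ω' _ h
    have h' := Finsupp.equivFunOnFinite.symm.injective h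
    refine multiplicity_injective hκ hn (hw ω) (hw ω') (funext fun q => ?_)
    exact Nat.eq_of_mul_eq_mul_left q.length_pos (congrFun h' q)
  · intro ω _
    rw [Finset.mem_coe, Finset.mem_finsuppAntidiag]
    exact ⟨sum_length_mul_multiplicity hn ω (w ω), Finset.subset_univ _⟩
  -- A choice matched with no word has an exponent not divisible by the length of its necklace, so
  -- its term is zero.
  · intro l hl hne
    obtain ⟨hl1, -⟩ := Finset.mem_finsuppAntidiag.1 hl
    by_contra hprod
    have hdvd : ∀ q : Necklace α N, q.length ∣ l q := by
      intro q
      by_contra hq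
      exact hprod (Finset.prod_eq_zero (Finset.mem_univ q) (coeff_spread_of_not_dvd (R := R) hq _))
    choose K hK using hdvd
    obtain ⟨ω, w', hw', hmul⟩ := exists_multiplicity_eq hκ ε hn K (by
      rw [← hl1]
      exact Finset.sum_congr rfl fun q _ => (hK q).symm)
    rw [hw'.unique (hw ω)] at hmul
    refine hne ⟨ω, Finset.mem_coe.2 (Finset.mem_univ _), ?_⟩
    ext q
    simp [hmul, hK]
  · intro ω _
    have h1 : ∀ i ∈ Finset.Icc 1 (2 * N), x i ^ cycleCount i (w ω) = ∏ q : Necklace α N,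
        x i ^ cycleContribution q.length (q.sign ε) (multiplicity hn ω (w ω) q) i := by
      intro i hi
      rw [cycleCount_eq_sum hn (hw ω) (Finset.mem_Icc.1 hi).1, Finset.prod_pow_eq_pow_sum]
    rw [Finset.prod_congr rfl h1, Finset.prod_comm]
    refine Finset.prod_congr rfl fun (q : Necklace α N) _ => ?_
    rw [prod_pow_cycleContribution x q.length_pos q.length_le, necklaceSeries]
    have hl : (Finsupp.equivFunOnFinite.symm fun q : Necklace α N =>
        q.length * multiplicity hn ω (w ω) q) q = q.length * multiplicity hn ω (w ω) q := rfl
    rw [hl, coeff_spread_mul q.length_pos]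

lemma prod_necklace [Fintype α] {M : Type*} [CommMonoid M] (F : ℕ → ℤˣ → M) :
    ∏ q : Necklace α N, F q.length (q.sign ε) = ∏ p ∈ Finset.Icc 1 N,
      F p 1 ^ necklaceCount ε 1 p * F p (-1) ^ necklaceCount ε (-1) p := by
  classical
  rw [← Finset.prod_fiberwise_of_maps_to (t := Finset.Icc 1 N)
    (g := fun q : Necklace α N => q.length)
    (fun q _ => Finset.mem_Icc.2 ⟨Necklace.length_pos q, Necklace.length_le q⟩)]
  refine Finset.prod_congr rfl fun p hp => ?_
  obtain ⟨hp1, hpN⟩ := Finset.mem_Icc.1 hp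
  have hsplit : (Finset.univ.filter fun q : Necklace α N => q.length = p) =
      (Finset.univ.filter fun q : Necklace α N => q.length = p ∧ q.sign ε = 1) ∪
      (Finset.univ.filter fun q : Necklace α N => q.length = p ∧ q.sign ε = -1) := by
    ext q
    simp only [Finset.mem_filter, Finset.mem_union, Finset.mem_univ, true_and]
    constructor
    · intro h
      exact (Int.units_eq_one_or _).imp (fun h' => ⟨h, h'⟩) (fun h' => ⟨h, h'⟩)
    · rintro (⟨h, -⟩ | ⟨h, -⟩) <;> exact h
  rw [hsplit, Finset.prod_union, ← card_necklace (ε := ε) 1 hp1 hpN,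
    ← card_necklace (ε := ε) (-1) hp1 hpN]
  · congr 1
    · refine Finset.prod_eq_pow_card fun q hq => ?_
      have hq' := (Finset.mem_filter.1 hq).2
      rw [hq'.1, hq'.2]
    · refine Finset.prod_eq_pow_card fun q hq => ?_
      have hq' := (Finset.mem_filter.1 hq).2
      rw [hq'.1, hq'.2]
  · rw [Finset.disjoint_filter]
    rintro q - ⟨-, h1⟩ ⟨-, h2⟩
    rw [h1] at h2
    exact absurd h2 (by decide)

lemma prod_Icc_double {M : Type*} [CommMonoid M] (A : ℕ → M) (hA : ∀ i, N < i → A i = 1)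
    (f : ℕ → ℕ) :
    ∏ p ∈ Finset.Icc 1 N, A (2 * p) ^ f p =
      ∏ i ∈ Finset.Icc 1 N, A i ^ (if Even i then f (i / 2) else 0) := by
  simp only [pow_ite, pow_zero]
  rw [← Finset.prod_filter, ← Finset.prod_filter_of_ne (p := fun p => 2 * p ≤ N)]
  · refine Finset.prod_bij' (fun p _ => 2 * p) (fun i _ => i / 2) ?_ ?_ ?_ ?_ ?_
    · intro p hp
      simp only [Finset.mem_filter, Finset.mem_Icc] at hp ⊢
      exact ⟨by omega, even_two_mul p⟩
    · intro i hi
      simp only [Finset.mem_filter, Finset.mem_Icc] at hi ⊢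
      obtain ⟨⟨h1, h2⟩, k, hk⟩ := hi
      omega
    · intro p _
      simp
    · intro i hi
      exact Nat.two_mul_div_two_of_even (Finset.mem_filter.1 hi).2
    · intro p _
      simp
  · intro p _ hne
    by_contra hlt
    exact hne (by rw [hA _ (not_le.1 hlt), one_pow])

/-- The cycle index of the sorting permutations of signed words, up to degree `N`. -/
theorem cycleIndex_identity [Fintype α] (hε : ∑ a, (ε a : ℤ) = 0) (x : ℕ → R)
    (hx : ∀ i, N < i → x i = 0) :
    (∏ q : Necklace α N, necklaceSeries x q.length (q.sign ε)) *
      ∏ i ∈ Finset.Icc 1 N, (1 - C (x i) * X ^ i) ^ necklaceCount ε (-1) i =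
    ∏ i ∈ Finset.Icc 1 N, (1 + C (x i) * X ^ i) ^ necklaceCount ε (-1) i := by
  let A : ℕ → R⟦X⟧ := fun i => 1 - C (x i) * X ^ i
  let B : ℕ → R⟦X⟧ := fun i => 1 + C (x i) * X ^ i
  have hA : ∀ i, N < i → A i = 1 := fun i hi => by simp [A, hx i hi]
  have hneg : ¬ ((-1 : ℤˣ) = 1) := by decide
  have hq : ∀ q : Necklace α N, necklaceSeries x q.length (q.sign ε) *
      (fun p (s : ℤˣ) => if s = 1 then A p else A (2 * p)) q.length (q.sign ε) =
      (fun p (s : ℤˣ) => if s = 1 then 1 else B p) q.length (q.sign ε) := by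
    intro q
    simp only [necklaceSeries]
    split_ifs with hs
    · exact spread_pow_mul q.length_pos _
    · exact spread_alternating_mul q.length_pos _ _
  have hprod := Finset.prod_congr (rfl : (Finset.univ : Finset (Necklace α N)) = Finset.univ)
    fun q _ => hq q
  rw [Finset.prod_mul_distrib,
    prod_necklace (fun p (s : ℤˣ) => if s = 1 then A p else A (2 * p)),
    prod_necklace (fun p (s : ℤˣ) => if s = 1 then 1 else B p)] at hprod
  simp only [if_true, if_neg hneg, one_pow, one_mul] at hprod
  -- The denominators of negative necklaces of length `p` are moved to the index `2p`, to join those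
  -- of the positive necklaces of that length; beyond `N` they are `1`.
  rw [Finset.prod_mul_distrib, prod_Icc_double A hA, ← Finset.prod_mul_distrib] at hprod
  rw [← hprod]
  congr 1
  refine Finset.prod_congr rfl fun i hi => ?_
  rw [← pow_add, necklaceCount_one hε (Finset.mem_Icc.1 hi).1]

end CycleIndex

/-! ### Joint cycle counts for a finite set of lengths -/

section JointCounts

open PowerSeries

lemma cycleCount_eq_zero_of_lt {n i : ℕ} (w : Equiv.Perm (Fin n)) (hi : n < i) :
    cycleCount i w = 0 := by
  rw [cycleCount, Multiset.count_eq_zero]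
  intro h
  have := Nat.Partition.le_of_mem_parts h
  rw [Fintype.card_fin] at this
  omega

section Ring

variable {R : Type*} [CommRing R]

lemma isUnit_one_add_C_mul_X_pow (a : R) {i : ℕ} (hi : 0 < i) :
    IsUnit (1 + C a * X ^ i : R⟦X⟧) := by
  rw [isUnit_iff_constantCoeff]
  simp [hi.ne']

lemma isUnit_one_sub_C_mul_X_pow (a : R) {i : ℕ} (hi : 0 < i) :
    IsUnit (1 - C a * X ^ i : R⟦X⟧) := by
  rw [isUnit_iff_constantCoeff]
  simp [hi.ne']

lemma eq_of_forall_X_pow_dvd {φ ψ : R⟦X⟧} (N₀ : ℕ) (h : ∀ N, N₀ ≤ N → X ^ (N + 1) ∣ φ - ψ) :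
    φ = ψ := by
  ext n
  have := X_pow_dvd_iff.1 (h (n + N₀) (by omega)) n (by omega)
  rw [map_sub] at this
  exact sub_eq_zero.1 this

lemma mk_pow_mul_one_sub (k : R) : PowerSeries.mk (fun n => k ^ n) * (1 - C k * X) = 1 := by
  have h := spread_pow_mul (p := 1) one_pos k
  rw [pow_one] at h
  convert h using 2
  ext n
  simp [spread]

variable {α : Type*} [Fintype α] {κ : α → ℤ} {ε : α → ℤˣ}

/-- A permutation of `n ≤ N` letters has no cycle longer than `N`, so setting the variables beyond
`N` to zero loses nothing in degree `n`. -/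
lemma cycleIndex_coeff (hκ : Function.Injective κ)
    (w : ∀ n, (Fin n → α) → Equiv.Perm (Fin n)) (hw : ∀ n ω, IsSorting κ ε ω (w n ω))
    {S : Finset ℕ} {n N : ℕ} (hn : n ≤ N) (hS : S ⊆ Finset.Icc 1 N) (x : ℕ → R) :
    coeff n (∏ q : Necklace α N, necklaceSeries
      (fun i => if i ∈ S then x i else if i ≤ N then 1 else 0) q.length (q.sign ε)) =
    ∑ ω : Fin n → α, ∏ i ∈ S, x i ^ cycleCount i (w n ω) := by
  rw [← sum_prod_cycleCount_eq_coeff hκ hn _ (w n) (hw n)]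
  refine Finset.sum_congr rfl fun ω _ => ?_
  have hsub : S ⊆ Finset.Icc 1 (2 * N) := fun i hi => by
    have := Finset.mem_Icc.1 (hS hi)
    exact Finset.mem_Icc.2 (by omega)
  rw [← Finset.prod_subset hsub (f := fun i =>
    (if i ∈ S then x i else if i ≤ N then 1 else 0) ^ cycleCount i (w n ω))]
  · exact Finset.prod_congr rfl fun i hi => by rw [if_pos hi]
  · intro i _ hi
    rw [if_neg hi]
    split_ifs with h
    · exact one_pow _
    · rw [cycleCount_eq_zero_of_lt _ (by omega), pow_zero]

/-- The generating function of the cycle counts with lengths in a finite set. -/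
lemma jointGenFun_identity (hκ : Function.Injective κ) (hε : ∑ a, (ε a : ℤ) = 0)
    (w : ∀ n, (Fin n → α) → Equiv.Perm (Fin n)) (hw : ∀ n ω, IsSorting κ ε ω (w n ω))
    {S : Finset ℕ} (hS : ∀ i ∈ S, 0 < i) (x : ℕ → R) :
    (PowerSeries.mk fun n => ∑ ω : Fin n → α, ∏ i ∈ S, x i ^ cycleCount i (w n ω)) *
      (∏ i ∈ S, (1 - C (x i) * X ^ i) ^ necklaceCount ε (-1) i) *
      (∏ i ∈ S, (1 + X ^ i) ^ necklaceCount ε (-1) i) * (1 - C (Fintype.card α : R) * X) =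
    (∏ i ∈ S, (1 + C (x i) * X ^ i) ^ necklaceCount ε (-1) i) *
      ∏ i ∈ S, (1 - X ^ i) ^ necklaceCount ε (-1) i := by
  classical
  refine eq_of_forall_X_pow_dvd (S.sup id) fun N hN => ?_
  have hSN : S ⊆ Finset.Icc 1 N := fun i hi =>
    Finset.mem_Icc.2 ⟨hS i hi, (Finset.le_sup (f := id) hi).trans hN⟩
  set F : R⟦X⟧ := PowerSeries.mk fun n => ∑ ω : Fin n → α, ∏ i ∈ S, x i ^ cycleCount i (w n ω)
  let f : ℕ → ℕ := necklaceCount ε (-1)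
  -- the cycle index with the variables `y i` for `i ∈ S`, and `1` for the other `i ≤ N`
  let Φ : (ℕ → R) → R⟦X⟧ := fun y => ∏ q : Necklace α N, necklaceSeries
    (fun i => if i ∈ S then y i else if i ≤ N then 1 else 0) q.length (q.sign ε)
  have hF : X ^ (N + 1) ∣ F - Φ x := X_pow_dvd_iff.2 fun n hn => by
    rw [map_sub, cycleIndex_coeff hκ w hw (by omega) hSN, coeff_mk, sub_self]
  -- With all variables equal to `1` every word counts once.
  have hG : X ^ (N + 1) ∣ PowerSeries.mk (fun n => (Fintype.card α : R) ^ n) - Φ (fun _ => 1) :=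
    X_pow_dvd_iff.2 fun n hn => by
      rw [map_sub, cycleIndex_coeff hκ w hw (by omega) hSN, coeff_mk]
      simp
  have hΦ : ∀ y : ℕ → R, Φ y * ((∏ i ∈ S, (1 - C (y i) * X ^ i) ^ f i) *
      ∏ i ∈ Finset.Icc 1 N \ S, (1 - X ^ i) ^ f i) =
      (∏ i ∈ S, (1 + C (y i) * X ^ i) ^ f i) *
        ∏ i ∈ Finset.Icc 1 N \ S, (1 + X ^ i) ^ f i := by
    intro y
    have h := cycleIndex_identity (N := N) hε
      (fun i => if i ∈ S then y i else if i ≤ N then 1 else 0) (fun i hi => by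
        rw [if_neg (fun h => by have := Finset.mem_Icc.1 (hSN h); omega), if_neg (by omega)])
    have hsplit : ∀ e : R → ℕ → R⟦X⟧,
        ∏ i ∈ Finset.Icc 1 N, e (if i ∈ S then y i else if i ≤ N then 1 else 0) i =
          (∏ i ∈ S, e (y i) i) * ∏ i ∈ Finset.Icc 1 N \ S, e 1 i := fun e => by
      rw [← Finset.prod_sdiff hSN, mul_comm]
      congr 1
      · exact Finset.prod_congr rfl fun i hi => by rw [if_pos hi]
      · refine Finset.prod_congr rfl fun i hi => ?_
        obtain ⟨h1, h2⟩ := Finset.mem_sdiff.1 hi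
        rw [if_neg h2, if_pos (Finset.mem_Icc.1 h1).2]
    rw [hsplit fun a i => (1 - C a * X ^ i) ^ necklaceCount ε (-1) i,
      hsplit fun a i => (1 + C a * X ^ i) ^ necklaceCount ε (-1) i] at h
    simpa only [map_one, one_mul] using h
  have h1 := hΦ x
  have h2 := hΦ fun _ => 1
  simp only [map_one, one_mul] at h2
  have hu1 : IsUnit (∏ i ∈ Finset.Icc 1 N \ S, (1 - X ^ i : R⟦X⟧) ^ f i) :=
    IsUnit.prod_iff.2 fun i hi => by
      have := (isUnit_one_sub_C_mul_X_pow (1 : R)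
        (Finset.mem_Icc.1 (Finset.mem_sdiff.1 hi).1).1).pow (f i)
      rwa [map_one, one_mul] at this
  have hu2 : IsUnit (∏ i ∈ Finset.Icc 1 N \ S, (1 + X ^ i : R⟦X⟧) ^ f i) :=
    IsUnit.prod_iff.2 fun i hi => by
      have := (isUnit_one_add_C_mul_X_pow (1 : R)
        (Finset.mem_Icc.1 (Finset.mem_sdiff.1 hi).1).1).pow (f i)
      rwa [map_one, one_mul] at this
  set a := ∏ i ∈ S, (1 - C (x i) * X ^ i : R⟦X⟧) ^ f i
  set b := ∏ i ∈ S, (1 + C (x i) * X ^ i : R⟦X⟧) ^ f i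
  set a' := ∏ i ∈ S, (1 - X ^ i : R⟦X⟧) ^ f i
  set b' := ∏ i ∈ S, (1 + X ^ i : R⟦X⟧) ^ f i
  -- In the quotient of the identities for `x` and for `1` the factors outside `S` cancel.
  have h3 : Φ x * a * b' = b * a' * Φ (fun _ => 1) := by
    apply (hu1.mul hu2).mul_left_cancel
    linear_combination h1 * b' * ∏ i ∈ Finset.Icc 1 N \ S, (1 + X ^ i : R⟦X⟧) ^ f i -
      b * (∏ i ∈ Finset.Icc 1 N \ S, (1 + X ^ i : R⟦X⟧) ^ f i) * h2
  have h4 := mk_pow_mul_one_sub (Fintype.card α : R)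
  have h5 : F * a * b' * (1 - C (Fintype.card α : R) * X) - b * a' =
      (F - Φ x) * (a * b' * (1 - C (Fintype.card α : R) * X)) -
      (PowerSeries.mk (fun n => (Fintype.card α : R) ^ n) - Φ (fun _ => 1)) *
        (b * a' * (1 - C (Fintype.card α : R) * X)) := by
    linear_combination (1 - C (Fintype.card α : R) * X) * h3 + b * a' * h4
  rw [h5]
  exact dvd_sub (hF.mul_right _) (hG.mul_right _)

/-- The coefficients of `((1 + X) / (1 - X)) ^ f`. -/
def bernoulliGeometricCoeff (f k : ℕ) : ℕ :=
  ∑ ab ∈ Finset.HasAntidiagonal.antidiagonal k, f.choose ab.1 * (f + ab.2 - 1).choose ab.2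

lemma coeff_invOneSubPow (f k : ℕ) :
    coeff k (invOneSubPow R f).val = ((f + k - 1).choose k : R) := by
  -- For `f = 0` truncated subtraction makes `(k - 1).choose k` equal to `1` at `k = 0` and `0`
  -- otherwise, as required.
  rcases f with _ | f
  · rw [invOneSubPow_zero, Units.val_one, coeff_one]
    rcases k with _ | k
    · simp
    · simp
  · rw [invOneSubPow_val_succ_eq_mk_add_choose, coeff_mk]
    have : f + 1 + k - 1 = f + k := by omega
    rw [this, Nat.choose_symm_add]

lemma coeff_one_add_X_pow_mul (f k : ℕ) :
    coeff k ((1 + X) ^ f * (invOneSubPow R f).val) = (bernoulliGeometricCoeff f k : R) := by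
  rw [coeff_mul, bernoulliGeometricCoeff, Nat.cast_sum]
  refine Finset.sum_congr rfl fun ab _ => ?_
  rw [coeff_invOneSubPow, Nat.cast_mul]
  congr 1
  have h : ((1 + X) ^ f : R⟦X⟧) = (((1 + Polynomial.X) ^ f : Polynomial R) : R⟦X⟧) := by
    simp
  rw [h, Polynomial.coeff_coe, Polynomial.coeff_one_add_X_pow]

/-- The expansion of `((1 + a X ^ i) / (1 - a X ^ i)) ^ f`. -/
lemma spread_bernoulliGeometricCoeff (a : R) {i : ℕ} (hi : 0 < i) (f : ℕ) :
    spread i (fun k => (bernoulliGeometricCoeff f k : R) * a ^ k) * (1 - C a * X ^ i) ^ f =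
      (1 + C a * X ^ i) ^ f := by
  -- The substitution `X ↦ a X^i` is a rescaling followed by an expansion.
  have hX : expand i hi.ne' (rescale a (X : R⟦X⟧)) = C a * X ^ i := by
    rw [rescale_X, map_mul, expand_C, expand_X]
  have hs : spread i (fun k => (bernoulliGeometricCoeff f k : R) * a ^ k) =
      expand i hi.ne' (rescale a ((1 + X) ^ f * (invOneSubPow R f).val)) := by
    ext l
    by_cases hl : i ∣ l
    · obtain ⟨k, rfl⟩ := hl
      rw [coeff_spread_mul hi, coeff_expand_mul, coeff_rescale, coeff_one_add_X_pow_mul, mul_comm]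
    · rw [coeff_spread_of_not_dvd hl, coeff_expand_of_not_dvd _ _ _ hl]
  have h1 : (1 - C a * X ^ i : R⟦X⟧) = expand i hi.ne' (rescale a (1 - X)) := by
    rw [map_sub, map_sub, hX, map_one, map_one]
  have h2 : (1 + C a * X ^ i : R⟦X⟧) = expand i hi.ne' (rescale a (1 + X)) := by
    rw [map_add, map_add, hX, map_one, map_one]
  rw [hs, h1, h2, ← map_pow, ← map_pow, ← map_mul, ← map_mul, ← map_pow, ← map_pow]
  congr 2
  rw [mul_assoc, ← invOneSubPow_inv_eq_one_sub_pow R f]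
  have := (invOneSubPow R f).val_inv
  rw [this, mul_one]

/-- In this form the variables `x i` occur in explicit series only, so the coefficient of a monomial
in them can be read off. -/
lemma jointGenFun_identity' (hκ : Function.Injective κ) (hε : ∑ a, (ε a : ℤ) = 0)
    (w : ∀ n, (Fin n → α) → Equiv.Perm (Fin n)) (hw : ∀ n ω, IsSorting κ ε ω (w n ω))
    {S : Finset ℕ} (hS : ∀ i ∈ S, 0 < i) (x : ℕ → R) :
    (PowerSeries.mk fun n => ∑ ω : Fin n → α, ∏ i ∈ S, x i ^ cycleCount i (w n ω)) *
      ((∏ i ∈ S, (1 + X ^ i) ^ necklaceCount ε (-1) i) * (1 - C (Fintype.card α : R) * X)) =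
    (∏ i ∈ S, spread i fun k =>
        (bernoulliGeometricCoeff (necklaceCount ε (-1) i) k : R) * x i ^ k) *
      ∏ i ∈ S, (1 - X ^ i) ^ necklaceCount ε (-1) i := by
  have h := jointGenFun_identity hκ hε w hw hS x
  have h1 : ∀ i ∈ S, (1 + C (x i) * X ^ i : R⟦X⟧) ^ necklaceCount ε (-1) i = _ :=
    fun i hi => (spread_bernoulliGeometricCoeff (x i) (hS i hi) _).symm
  rw [Finset.prod_congr rfl h1, Finset.prod_mul_distrib] at h
  have hu : IsUnit (∏ i ∈ S, (1 - C (x i) * X ^ i : R⟦X⟧) ^ necklaceCount ε (-1) i) :=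
    IsUnit.prod_iff.2 fun i hi => (isUnit_one_sub_C_mul_X_pow (x i) (hS i hi)).pow _
  apply hu.mul_left_cancel
  linear_combination h

end Ring

end JointCounts

/-! ### The number of signed words with given cycle counts -/

section CountWords

open PowerSeries

/-- The coefficient of a monomial, extracted from each coefficient of a power series. -/
noncomputable def extractCoeff (e : ℕ →₀ ℕ) (φ : (MvPolynomial ℕ ℝ)⟦X⟧) : ℝ⟦X⟧ :=
  PowerSeries.mk fun n => MvPolynomial.coeff e (coeff n φ)

lemma extractCoeff_mul_map (e : ℕ →₀ ℕ) (φ : (MvPolynomial ℕ ℝ)⟦X⟧) (G : ℝ⟦X⟧) :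
    extractCoeff e (φ * PowerSeries.map MvPolynomial.C G) = extractCoeff e φ * G := by
  ext n
  simp only [extractCoeff, coeff_mk, coeff_mul, coeff_map, MvPolynomial.coeff_sum]
  refine Finset.sum_congr rfl fun x _ => ?_
  rw [mul_comm, MvPolynomial.coeff_C_mul, mul_comm]

lemma coeff_prod_X_pow (S : Finset ℕ) (j a : ℕ → ℕ) :
    MvPolynomial.coeff (∑ i ∈ S, Finsupp.single i (j i))
      (∏ i ∈ S, (MvPolynomial.X i : MvPolynomial ℕ ℝ) ^ a i) =
      if ∀ i ∈ S, a i = j i then 1 else 0 := by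
  classical
  have h1 : (∏ i ∈ S, (MvPolynomial.X i : MvPolynomial ℕ ℝ) ^ a i) =
      MvPolynomial.monomial (∑ i ∈ S, Finsupp.single i (a i)) 1 := by
    rw [MvPolynomial.monomial_sum_one]
    exact Finset.prod_congr rfl fun i _ => MvPolynomial.X_pow_eq_monomial
  have hval : ∀ b : ℕ → ℕ, ∀ k ∈ S, (∑ i ∈ S, Finsupp.single i (b i)) k = b k := by
    intro b k hk
    rw [Finsupp.finsetSum_apply, Finset.sum_eq_single k]
    · simp
    · intro i _ hik
      exact Finsupp.single_eq_of_ne hik.symm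
    · exact fun h => absurd hk h
  rw [h1, MvPolynomial.coeff_monomial]
  congr 1
  refine propext ⟨fun h i hi => ?_, fun h => Finset.sum_congr rfl fun i hi => by rw [h i hi]⟩
  rw [← hval a i hi, ← hval j i hi, h]

/-- In the `i`-th factor the power of the variable fixes the power of `X`, so only one term
survives. -/
lemma extractCoeff_prod_spread {S : Finset ℕ} (hS : ∀ i ∈ S, 0 < i) (c : ℕ → ℕ → ℕ)
    (j : ℕ → ℕ) :
    extractCoeff (∑ i ∈ S, Finsupp.single i (j i))
      (∏ i ∈ S, spread i fun k => (c i k : MvPolynomial ℕ ℝ) * MvPolynomial.X i ^ k) =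
    ∏ i ∈ S, C (c i (j i) : ℝ) * X ^ (i * j i) := by
  classical
  ext n
  rw [extractCoeff, coeff_mk, coeff_prod, coeff_prod, MvPolynomial.coeff_sum]
  refine Finset.sum_congr rfl fun l _ => ?_
  simp only [coeff_C_mul, coeff_X_pow]
  by_cases hl : ∀ i ∈ S, i ∣ l i
  · have h1 : ∀ i ∈ S, l i = i * (l i / i) := fun i hi => (Nat.mul_div_cancel' (hl i hi)).symm
    have h2 : ∀ i ∈ S, coeff (l i)
        (spread i fun k => (c i k : MvPolynomial ℕ ℝ) * MvPolynomial.X i ^ k) =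
        (c i (l i / i) : MvPolynomial ℕ ℝ) * MvPolynomial.X i ^ (l i / i) := fun i hi => by
      conv_lhs => rw [h1 i hi]
      rw [coeff_spread_mul (hS i hi)]
    rw [Finset.prod_congr rfl h2, Finset.prod_mul_distrib, ← Nat.cast_prod,
      ← map_natCast (MvPolynomial.C (σ := ℕ) (R := ℝ)), MvPolynomial.coeff_C_mul,
      coeff_prod_X_pow]
    split_ifs with h3
    · rw [mul_one, Nat.cast_prod]
      refine Finset.prod_congr rfl fun i hi => ?_
      have h4 : l i = i * j i := by rw [← h3 i hi]; exact h1 i hi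
      rw [if_pos h4, mul_one, h3 i hi]
    · push Not at h3
      obtain ⟨i, hi, hne⟩ := h3
      rw [mul_zero]
      refine (Finset.prod_eq_zero hi ?_).symm
      rw [if_neg, mul_zero]
      intro h4
      exact hne (by rw [h4, Nat.mul_div_cancel_left _ (hS i hi)])
  · push Not at hl
    obtain ⟨i, hi, hd⟩ := hl
    rw [Finset.prod_eq_zero hi (coeff_spread_of_not_dvd hd _), MvPolynomial.coeff_zero]
    refine (Finset.prod_eq_zero hi ?_).symm
    rw [if_neg (fun h : l i = i * j i => hd (h ▸ dvd_mul_right _ _)), mul_zero]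

variable {α : Type*} [Fintype α] {κ : α → ℤ} {ε : α → ℤˣ}

/-- The number of signed words of length `n` whose sorting permutation has prescribed cycle
counts. -/
lemma countGenFun_identity (hκ : Function.Injective κ) (hε : ∑ a, (ε a : ℤ) = 0)
    (w : ∀ n, (Fin n → α) → Equiv.Perm (Fin n)) (hw : ∀ n ω, IsSorting κ ε ω (w n ω))
    {S : Finset ℕ} (hS : ∀ i ∈ S, 0 < i) (j : ℕ → ℕ) :
    (PowerSeries.mk fun n =>
        (({ω : Fin n → α | ∀ i ∈ S, cycleCount i (w n ω) = j i} : Set _).ncard : ℝ)) *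
      ((∏ i ∈ S, (1 + X ^ i) ^ necklaceCount ε (-1) i) * (1 - C (Fintype.card α : ℝ) * X)) =
    (∏ i ∈ S, C (bernoulliGeometricCoeff (necklaceCount ε (-1) i) (j i) : ℝ) * X ^ (i * j i)) *
      ∏ i ∈ S, (1 - X ^ i) ^ necklaceCount ε (-1) i := by
  classical
  -- The variables are taken as indeterminates; a monomial then records the prescribed cycle counts.
  have h := jointGenFun_identity' (R := MvPolynomial ℕ ℝ) hκ hε w hw hS MvPolynomial.X
  have h1 : ((∏ i ∈ S, (1 + X ^ i : (MvPolynomial ℕ ℝ)⟦X⟧) ^ necklaceCount ε (-1) i) *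
      (1 - C (Fintype.card α : MvPolynomial ℕ ℝ) * X)) = PowerSeries.map MvPolynomial.C
        ((∏ i ∈ S, (1 + X ^ i) ^ necklaceCount ε (-1) i) * (1 - C (Fintype.card α : ℝ) * X)) := by
    simp [map_prod]
  have h2 : (∏ i ∈ S, (1 - X ^ i : (MvPolynomial ℕ ℝ)⟦X⟧) ^ necklaceCount ε (-1) i) =
      PowerSeries.map MvPolynomial.C (∏ i ∈ S, (1 - X ^ i) ^ necklaceCount ε (-1) i) := by
    simp [map_prod]
  rw [h1, h2] at h
  have h' := congrArg (extractCoeff (∑ i ∈ S, Finsupp.single i (j i))) h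
  rw [extractCoeff_mul_map, extractCoeff_mul_map, extractCoeff_prod_spread hS
    fun i k => bernoulliGeometricCoeff (necklaceCount ε (-1) i) k] at h'
  rw [← h']
  congr 1
  ext n
  rw [coeff_mk, extractCoeff, coeff_mk, coeff_mk, MvPolynomial.coeff_sum]
  simp only [coeff_prod_X_pow]
  rw [Finset.sum_boole, ← Set.ncard_coe_finset]
  simp

end CountWords

/-! ### Evaluation of power series -/

section Evaluation

open PowerSeries

/-- The power series `φ` converges absolutely at `t`, with value `v`. -/
def EvalsTo (φ : ℝ⟦X⟧) (t v : ℝ) : Prop :=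
  Summable (fun n => ‖coeff n φ * t ^ n‖) ∧ HasSum (fun n => coeff n φ * t ^ n) v

variable {φ ψ : ℝ⟦X⟧} {t v w : ℝ}

lemma EvalsTo.unique (h : EvalsTo φ t v) (h' : EvalsTo φ t w) : v = w := h.2.unique h'.2

lemma exists_evalsTo (h : Summable (fun n => ‖coeff n φ * t ^ n‖)) : ∃ v, EvalsTo φ t v :=
  ⟨_, h, h.of_norm.hasSum⟩

lemma evalsTo_C (a : ℝ) : EvalsTo (C a) t a := by
  have h : HasSum (fun n => coeff n (C a : ℝ⟦X⟧) * t ^ n) (coeff 0 (C a : ℝ⟦X⟧) * t ^ 0) :=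
    hasSum_single 0 fun n hn => by simp [coeff_C, hn]
  refine ⟨?_, by simpa using h⟩
  exact summable_of_ne_finset_zero (s := {0}) fun n hn => by
    have : n ≠ 0 := by simpa using hn
    simp [coeff_C, this]

lemma evalsTo_X : EvalsTo X t t := by
  have h : HasSum (fun n => coeff n (X : ℝ⟦X⟧) * t ^ n) (coeff 1 (X : ℝ⟦X⟧) * t ^ 1) :=
    hasSum_single 1 fun n hn => by simp [coeff_X, hn]
  refine ⟨?_, by simpa using h⟩
  exact summable_of_ne_finset_zero (s := {1}) fun n hn => by
    have : n ≠ 1 := by simpa using hn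
    simp [coeff_X, this]

lemma EvalsTo.add (h : EvalsTo φ t v) (h' : EvalsTo ψ t w) : EvalsTo (φ + ψ) t (v + w) := by
  have h2 := h.2.add h'.2
  simp only [← add_mul] at h2
  refine ⟨(h.1.add h'.1).of_nonneg_of_le (fun _ => norm_nonneg _) fun n => ?_, by simpa using h2⟩
  rw [map_add, add_mul]
  exact norm_add_le _ _

lemma EvalsTo.mul (h : EvalsTo φ t v) (h' : EvalsTo ψ t w) : EvalsTo (φ * ψ) t (v * w) := by
  have hterm : ∀ n, coeff n (φ * ψ) * t ^ n = ∑ kl ∈ Finset.HasAntidiagonal.antidiagonal n,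
      (coeff kl.1 φ * t ^ kl.1) * (coeff kl.2 ψ * t ^ kl.2) := fun n => by
    rw [coeff_mul, Finset.sum_mul]
    refine Finset.sum_congr rfl fun kl hkl => ?_
    rw [← Finset.HasAntidiagonal.mem_antidiagonal.1 hkl, pow_add]
    ring
  have hs := summable_norm_sum_mul_antidiagonal_of_summable_norm h.1 h'.1
  have ht := tsum_mul_tsum_eq_tsum_sum_antidiagonal_of_summable_norm h.1 h'.1
  rw [h.2.tsum_eq, h'.2.tsum_eq] at ht
  simp only [EvalsTo, hterm]
  refine ⟨hs, ?_⟩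
  rw [ht]
  exact hs.of_norm.hasSum

lemma EvalsTo.sub (h : EvalsTo φ t v) (h' : EvalsTo ψ t w) : EvalsTo (φ - ψ) t (v - w) := by
  have := h.add ((evalsTo_C (-1)).mul h')
  simpa [sub_eq_add_neg] using this

lemma EvalsTo.pow (h : EvalsTo φ t v) (n : ℕ) : EvalsTo (φ ^ n) t (v ^ n) := by
  induction n with
  | zero => simpa using evalsTo_C (t := t) 1
  | succ n ih => simpa only [pow_succ] using ih.mul h

lemma EvalsTo.prod {ι : Type*} (s : Finset ι) {φ : ι → ℝ⟦X⟧} {v : ι → ℝ}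
    (h : ∀ i ∈ s, EvalsTo (φ i) t (v i)) : EvalsTo (∏ i ∈ s, φ i) t (∏ i ∈ s, v i) := by
  classical
  induction s using Finset.induction_on with
  | empty => simpa using evalsTo_C (t := t) 1
  | insert i s hi ih =>
    rw [Finset.prod_insert hi, Finset.prod_insert hi]
    exact (h i (Finset.mem_insert_self i s)).mul
      (ih fun k hk => h k (Finset.mem_insert_of_mem hk))

lemma evalsTo_one_add_X_pow (i : ℕ) : EvalsTo (1 + X ^ i) t (1 + t ^ i) := by
  simpa using (evalsTo_C 1).add (evalsTo_X.pow i)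

lemma evalsTo_one_sub_X_pow (i : ℕ) : EvalsTo (1 - X ^ i) t (1 - t ^ i) := by
  simpa using (evalsTo_C 1).sub (evalsTo_X.pow i)

lemma exists_evalsTo_of_norm_coeff_le_one (hφ : ∀ n, ‖coeff n φ‖ ≤ 1) (ht0 : 0 ≤ t)
    (ht1 : t < 1) : ∃ v, EvalsTo φ t v := by
  refine exists_evalsTo ((summable_geometric_of_lt_one ht0 ht1).of_nonneg_of_le
    (fun _ => norm_nonneg _) fun n => ?_)
  rw [norm_mul, norm_pow, Real.norm_of_nonneg ht0]
  exact mul_le_of_le_one_left (pow_nonneg ht0 n) (hφ n)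

/-- The mass at `j` of the convolution of a binomial law with parameters `(f, q / (1 + q))` and a
negative binomial law with parameters `(f, q)`. -/
noncomputable def bernoulliGeometricMass (f : ℕ) (q : ℝ) (j : ℕ) : ℝ :=
  bernoulliGeometricCoeff f j * q ^ j * ((1 - q) / (1 + q)) ^ f

variable {α : Type*} [Fintype α] {κ : α → ℤ} {ε : α → ℤˣ}

/-- The number of signed words of length `n` whose sorting permutation has `j i` cycles of
length `i` for all `i ∈ S`. -/
noncomputable def wordCount (w : ∀ n, (Fin n → α) → Equiv.Perm (Fin n)) (S : Finset ℕ)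
    (j : ℕ → ℕ) (n : ℕ) : ℕ :=
  ({ω : Fin n → α | ∀ i ∈ S, cycleCount i (w n ω) = j i} : Set _).ncard

lemma wordCount_le (w : ∀ n, (Fin n → α) → Equiv.Perm (Fin n)) (S : Finset ℕ)
    (j : ℕ → ℕ) (n : ℕ) : wordCount w S j n ≤ Fintype.card α ^ n := by
  classical
  have h := Set.ncard_le_ncard
    (Set.subset_univ {ω : Fin n → α | ∀ i ∈ S, cycleCount i (w n ω) = j i})
  rw [Set.ncard_univ, Nat.card_eq_fintype_card, Fintype.card_fun, Fintype.card_fin] at h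
  exact h

lemma evalsTo_countRhs (S : Finset ℕ) (c f j : ℕ → ℕ) :
    EvalsTo ((∏ i ∈ S, C (c i : ℝ) * X ^ (i * j i)) * ∏ i ∈ S, (1 - X ^ i) ^ f i) t
      ((∏ i ∈ S, (c i : ℝ) * t ^ (i * j i)) * ∏ i ∈ S, (1 - t ^ i) ^ f i) :=
  (EvalsTo.prod S fun _ _ => (evalsTo_C _).mul (evalsTo_X.pow _)).mul
    (EvalsTo.prod S fun _ _ => (evalsTo_one_sub_X_pow _).pow _)

lemma prod_mass_eq (ht0 : 0 ≤ t) (S : Finset ℕ) (f j : ℕ → ℕ) {v : ℝ}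
    (h : v * ∏ i ∈ S, (1 + t ^ i) ^ f i =
      (∏ i ∈ S, (bernoulliGeometricCoeff (f i) (j i) : ℝ) * t ^ (i * j i)) *
        ∏ i ∈ S, (1 - t ^ i) ^ f i) :
    v = ∏ i ∈ S, bernoulliGeometricMass (f i) (t ^ i) (j i) := by
  have hne : ∏ i ∈ S, (1 + t ^ i) ^ f i ≠ 0 :=
    Finset.prod_ne_zero_iff.2 fun _ _ => by positivity
  rw [eq_div_of_mul_eq hne h, ← Finset.prod_mul_distrib, ← Finset.prod_div_distrib]
  refine Finset.prod_congr rfl fun i _ => ?_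
  rw [bernoulliGeometricMass, div_pow, ← pow_mul]
  ring

/-- The joint law of the cycle counts when the number of letters is geometric. -/
lemma hasSum_wordCount (hκ : Function.Injective κ) (hε : ∑ a, (ε a : ℤ) = 0)
    (w : ∀ n, (Fin n → α) → Equiv.Perm (Fin n)) (hw : ∀ n ω, IsSorting κ ε ω (w n ω))
    (hα : 1 < Fintype.card α) {S : Finset ℕ} (hS : ∀ i ∈ S, 0 < i) (j : ℕ → ℕ) {u : ℝ}
    (hu0 : 0 < u) (hu1 : u < 1) :
    HasSum (fun n => (1 - u) * u ^ n * (wordCount w S j n / (Fintype.card α : ℝ) ^ n))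
      (∏ i ∈ S, bernoulliGeometricMass (necklaceCount ε (-1) i)
        ((u / Fintype.card α) ^ i) (j i)) := by
  set k : ℝ := (Fintype.card α : ℝ) with hk
  have hk0 : 0 < k := by rw [hk]; exact_mod_cast (by omega : 0 < Fintype.card α)
  -- At this point `1 - k X` takes the value `1 - u`.
  set t := u / k with ht
  have ht0 : 0 ≤ t := by positivity
  have h := countGenFun_identity hκ hε w hw hS j
  set F : ℝ⟦X⟧ := PowerSeries.mk fun n =>
    (({ω : Fin n → α | ∀ i ∈ S, cycleCount i (w n ω) = j i} : Set _).ncard : ℝ) with hF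
  have hterm : ∀ n, coeff n F * t ^ n = u ^ n * (wordCount w S j n / k ^ n) := fun n => by
    rw [hF, coeff_mk, ht, div_pow, wordCount]
    ring
  have hle : ∀ n, (wordCount w S j n : ℝ) / k ^ n ≤ 1 := fun n => by
    rw [div_le_one (by positivity), hk]
    exact_mod_cast wordCount_le w S j n
  obtain ⟨v, hv⟩ := exists_evalsTo (φ := F) (t := t) <| by
    simp only [hterm]
    refine (summable_geometric_of_lt_one hu0.le hu1).of_nonneg_of_le
      (fun _ => norm_nonneg _) fun n => ?_
    rw [Real.norm_of_nonneg (by positivity)]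
    exact mul_le_of_le_one_right (by positivity) (hle n)
  have h1 := hv.mul ((EvalsTo.prod S fun i _ =>
    (evalsTo_one_add_X_pow (t := t) i).pow (necklaceCount ε (-1) i)).mul
      ((evalsTo_C 1).sub ((evalsTo_C k).mul evalsTo_X)))
  rw [map_one, h] at h1
  have h2 := h1.unique (evalsTo_countRhs S
    (fun i => bernoulliGeometricCoeff (necklaceCount ε (-1) i) (j i))
    (necklaceCount ε (-1)) j)
  have h3 : k * t = u := by rw [ht]; field_simp
  rw [h3] at h2
  rw [← prod_mass_eq ht0 S (necklaceCount ε (-1)) j (v := (1 - u) * v)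
    (by rw [← h2]; ring)]
  have h4 := hv.2.mul_left (1 - u)
  simp only [hterm] at h4
  simpa only [mul_assoc] using h4

/-- The limit law of the cycle counts. -/
lemma tendsto_wordCount (hκ : Function.Injective κ) (hε : ∑ a, (ε a : ℤ) = 0)
    (w : ∀ n, (Fin n → α) → Equiv.Perm (Fin n)) (hw : ∀ n ω, IsSorting κ ε ω (w n ω))
    (hα : 1 < Fintype.card α) {S : Finset ℕ} (hS : ∀ i ∈ S, 0 < i) (j : ℕ → ℕ) :
    Filter.Tendsto (fun n => (wordCount w S j n : ℝ) / (Fintype.card α : ℝ) ^ n) Filter.atTop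
      (nhds (∏ i ∈ S, bernoulliGeometricMass (necklaceCount ε (-1) i)
        ((1 / (Fintype.card α : ℝ)) ^ i) (j i))) := by
  set k : ℝ := (Fintype.card α : ℝ) with hk
  have hk1 : 1 < k := by rw [hk]; exact_mod_cast hα
  have hk0 : 0 < k := by linarith
  set t := 1 / k with ht
  have ht0 : 0 ≤ t := by positivity
  have ht1 : t < 1 := by rw [ht, div_lt_one hk0]; exact hk1
  have h := countGenFun_identity hκ hε w hw hS j
  set F : ℝ⟦X⟧ := PowerSeries.mk fun n =>
    (({ω : Fin n → α | ∀ i ∈ S, cycleCount i (w n ω) = j i} : Set _).ncard : ℝ) with hF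
  have hsp : ∀ i ∈ S, ∃ v, EvalsTo (spread i fun k => (-1 : ℝ) ^ k) t v := fun i _ =>
    exists_evalsTo_of_norm_coeff_le_one (fun n => by
      rw [spread, coeff_mk]
      split_ifs <;> simp) ht0 ht1
  have hinv : (∏ i ∈ S, (spread i fun k => (-1 : ℝ) ^ k) ^ necklaceCount ε (-1) i) *
      ∏ i ∈ S, (1 + X ^ i) ^ necklaceCount ε (-1) i = 1 := by
    rw [← Finset.prod_mul_distrib]
    refine Finset.prod_eq_one fun i hi => ?_
    have := spread_pow_mul (hS i hi) (-1 : ℝ)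
    rw [map_neg, map_one, neg_one_mul, sub_neg_eq_add] at this
    rw [← mul_pow, this, one_pow]
  -- `F` itself need not converge at `1 / k`, but `F (1 - k X)` is a polynomial times powers of the
  -- series `1 / (1 + X^i)`, which converge absolutely for `t < 1`.
  obtain ⟨v, hv⟩ : ∃ v, EvalsTo (F * (1 - C k * X)) t v := by
    choose! s hs using hsp
    have h1 := (evalsTo_countRhs (t := t) S
      (fun i => bernoulliGeometricCoeff (necklaceCount ε (-1) i) (j i))
      (necklaceCount ε (-1)) j).mul
      (EvalsTo.prod S fun i hi => (hs i hi).pow (necklaceCount ε (-1) i))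
    rw [← h] at h1
    refine Exists.intro _ (Eq.mp (congrArg (fun φ => EvalsTo φ t _) ?_) h1)
    linear_combination (F * (1 - C k * X)) * hinv
  have h1 := hv.mul (EvalsTo.prod S fun i _ =>
    (evalsTo_one_add_X_pow (t := t) i).pow (necklaceCount ε (-1) i))
  rw [mul_assoc, mul_comm (1 - C k * X), h] at h1
  have h2 := h1.unique (evalsTo_countRhs S
    (fun i => bernoulliGeometricCoeff (necklaceCount ε (-1) i) (j i))
    (necklaceCount ε (-1)) j)
  rw [← prod_mass_eq ht0 S (necklaceCount ε (-1)) j h2]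
  -- The coefficients of `F (1 - k X)` are `F_l - k F_{l-1}`, so at `t = 1 / k` the partial sums
  -- telescope.
  have hpart : ∀ n, ∑ l ∈ Finset.range (n + 1), coeff l (F * (1 - C k * X)) * t ^ l =
      (wordCount w S j n : ℝ) / k ^ n := by
    intro n
    have hc : ∀ n, coeff n F = wordCount w S j n := fun n => by rw [hF, coeff_mk]; rfl
    have hFX : F * (1 - C k * X) = F - C k * (F * X) := by ring
    rw [hFX]
    induction n with
    | zero => simp [hc]
    | succ n ih =>
      rw [Finset.sum_range_succ, ih, map_sub, coeff_C_mul, coeff_succ_mul_X, hc, hc, ht, one_div,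
        inv_pow]
      field_simp
      ring
  have h3 := (Filter.tendsto_add_atTop_iff_nat 1).2 hv.2.tendsto_sum_nat
  simpa only [hpart] using h3

end Evaluation

/-! ### The limit laws -/

section Laws

lemma coe_toProb {x : ℝ} (h0 : 0 ≤ x) (h1 : x ≤ 1) : (toProb x : ℝ) = x := by
  rw [toProb, Set.projIcc_of_mem _ ⟨h0, h1⟩]

lemma isProbabilityMeasure_negativeBinomial (f : ℕ) {p : unitInterval} (hp : (p : ℝ) < 1) :
    IsProbabilityMeasure (negativeBinomial f p) := by
  have h0 : (0 : ℝ) ≤ p := p.2.1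
  have h1 : 0 < 1 - (p : ℝ) := by linarith
  suffices hs : HasSum (fun j : ℕ =>
      ((f + j - 1).choose j : ℝ) * (p : ℝ) ^ j * (1 - (p : ℝ)) ^ f) 1 from
    hs.isProbabilityMeasure_sum_dirac (fun j => by positivity)
  rcases f with _ | f
  · convert hasSum_single (f := fun j : ℕ =>
      ((0 + j - 1).choose j : ℝ) * (p : ℝ) ^ j * (1 - (p : ℝ)) ^ 0) 0 ?_ using 1
    · simp
    · intro j hj
      rw [Nat.choose_eq_zero_of_lt (by omega)]
      simp
  · have h := (hasSum_choose_mul_geometric_of_norm_lt_one f (r := (p : ℝ))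
      (by rwa [Real.norm_of_nonneg h0])).mul_right ((1 - (p : ℝ)) ^ (f + 1))
    rw [one_div, inv_mul_cancel₀ (by positivity)] at h
    have hf : ∀ j, (f + 1 + j - 1).choose j = (j + f).choose f := fun j => by
      have : f + 1 + j - 1 = j + f := by omega
      rw [this, Nat.choose_symm_add]
    simp only [hf]
    exact h

lemma negativeBinomial_singleton (f : ℕ) (p : unitInterval) (j : ℕ) :
    negativeBinomial f p {j} =
      ENNReal.ofReal (((f + j - 1).choose j : ℝ) * (p : ℝ) ^ j * (1 - (p : ℝ)) ^ f) := by
  rw [negativeBinomial, Measure.sum_smul_dirac_singleton]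

lemma conv_singleton (μ ν : Measure ℕ) [SFinite μ] [SFinite ν] (j : ℕ) :
    Measure.conv μ ν {j} =
      ∑ ab ∈ Finset.HasAntidiagonal.antidiagonal j, μ {ab.1} * ν {ab.2} := by
  rw [Measure.conv, Measure.map_apply (by fun_prop) (measurableSet_singleton j)]
  have h : (fun x : ℕ × ℕ => x.1 + x.2) ⁻¹' {j} =
      ((Finset.HasAntidiagonal.antidiagonal j : Finset (ℕ × ℕ)) : Set (ℕ × ℕ)) := by
    ext x
    simp
  rw [h, ← sum_measure_singleton]
  refine Finset.sum_congr rfl fun ab _ => ?_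
  rw [← Measure.prod_prod, Set.singleton_prod_singleton]

/-- The convolution of the binomial and the negative binomial law. -/
noncomputable def cycleLaw (f : ℕ) (q : ℝ) : Measure ℕ :=
  Measure.conv (binomial f (toProb (q / (1 + q)))) (negativeBinomial f (toProb q))

lemma isProbabilityMeasure_cycleLaw (f : ℕ) {q : ℝ} (h0 : 0 ≤ q) (h1 : q < 1) :
    IsProbabilityMeasure (cycleLaw f q) := by
  have := isProbabilityMeasure_negativeBinomial f (p := toProb q)
    (by rwa [coe_toProb h0 h1.le])
  rw [cycleLaw]
  infer_instance

lemma bernoulliGeometricMass_nonneg (f : ℕ) {q : ℝ} (h0 : 0 ≤ q) (h1 : q < 1) (j : ℕ) :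
    0 ≤ bernoulliGeometricMass f q j := by
  have : 0 ≤ 1 - q := by linarith
  unfold bernoulliGeometricMass
  positivity

lemma cycleLaw_singleton (f : ℕ) {q : ℝ} (h0 : 0 ≤ q) (h1 : q < 1) (j : ℕ) :
    cycleLaw f q {j} = ENNReal.ofReal (bernoulliGeometricMass f q j) := by
  have := isProbabilityMeasure_negativeBinomial f (p := toProb q)
    (by rwa [coe_toProb h0 h1.le])
  have hq : 0 < 1 + q := by linarith
  have hq1 : 0 ≤ 1 - q := by linarith
  have hp0 : 0 ≤ q / (1 + q) := by positivity
  have hp1 : q / (1 + q) ≤ 1 := by rw [div_le_one hq]; linarith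
  have hp : 1 - q / (1 + q) = 1 / (1 + q) := by field_simp; ring
  rw [cycleLaw, conv_singleton, bernoulliGeometricMass, bernoulliGeometricCoeff, Nat.cast_sum,
    Finset.sum_mul, Finset.sum_mul, ENNReal.ofReal_sum_of_nonneg (fun _ _ => by positivity)]
  refine Finset.sum_congr rfl fun ab hab => ?_
  rw [binomial_singleton, negativeBinomial_singleton, coe_toProb h0 h1.le, coe_toProb hp0 hp1,
    ← ENNReal.ofReal_mul (by rw [hp]; positivity), hp]
  congr 1
  rw [← Finset.HasAntidiagonal.mem_antidiagonal.1 hab]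
  by_cases hle : ab.1 ≤ f
  · have h2 : (q / (1 + q)) ^ ab.1 * (1 / (1 + q)) ^ (f - ab.1) = q ^ ab.1 / (1 + q) ^ f := by
      rw [div_pow, div_pow, one_pow, div_mul_div_comm, mul_one, ← pow_add,
        Nat.add_sub_cancel' hle]
    rw [mul_assoc (f.choose ab.1 : ℝ), h2, div_pow, pow_add]
    push_cast
    ring
  -- Here the exponent `f - ab.1` is truncated, but the binomial coefficient vanishes.
  · rw [Nat.choose_eq_zero_of_lt (not_le.1 hle)]
    simp

/-- On a countable discrete space, pointwise convergence of the masses of probability measures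
implies convergence on every set. -/
lemma tendsto_measure_of_tendsto_singleton {Y : Type*} [Countable Y] [MeasurableSpace Y]
    [DiscreteMeasurableSpace Y] {ν : ℕ → Measure Y} {π : Measure Y}
    [∀ n, IsProbabilityMeasure (ν n)] [IsProbabilityMeasure π]
    (h : ∀ y, Filter.Tendsto (fun n => ν n {y}) Filter.atTop (nhds (π {y}))) (A : Set Y) :
    Filter.Tendsto (fun n => ν n A) Filter.atTop (nhds (π A)) := by
  -- Fatou's lemma for the counting measure, applied to the point masses on `A`.
  have key : ∀ A : Set Y, π A ≤ Filter.atTop.liminf fun n => ν n A := by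
    intro A
    have h1 : ∀ μ : Measure Y, μ A = ∫⁻ y, A.indicator (fun y => μ {y}) y ∂Measure.count :=
      fun μ => by
        rw [lintegral_count, Measure.tsum_indicator_apply_singleton μ A .of_discrete]
    have h2 : ∀ y, A.indicator (fun y => π {y}) y =
        Filter.atTop.liminf fun n => A.indicator (fun y => ν n {y}) y := by
      intro y
      by_cases hy : y ∈ A
      · simp only [Set.indicator_of_mem hy]
        exact (h y).liminf_eq.symm
      · simp [Set.indicator_of_notMem hy]
    rw [h1 π]
    simp only [h1 (ν _), h2]
    exact lintegral_liminf_le fun n => .of_discrete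
  -- For probability measures the lower bound on `Aᶜ` is an upper bound on `A`.
  refine tendsto_of_le_liminf_of_limsup_le (key A) ?_
  have := limsup_measure_compl_le_of_le_liminf_measure (MeasurableSet.of_discrete (s := Aᶜ))
    (key Aᶜ)
  simpa using this

end Laws

/-! ### The law of the cycle counts of the shelf shuffle -/

section ShelfLaw

variable {m : ℕ}

lemma card_letters : Fintype.card (Fin m × Bool) = 2 * m := by simp [mul_comm]

instance instDiscretePerm (n : ℕ) : DiscreteMeasurableSpace (Equiv.Perm (Fin n)) :=
  ⟨fun _ => trivial⟩

lemma shelfShuffle_apply (n : ℕ) (E : Set (Equiv.Perm (Fin n))) :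
    shelfShuffle m n E =
      ENNReal.ofReal ((shelfPerm ⁻¹' E : Set (Fin n → Fin m × Bool)).ncard / (2 * m : ℝ) ^ n) := by
  rw [shelfShuffle, Measure.map_apply .of_discrete .of_discrete, uniformOn_univ,
    Measure.count_apply_finite _ (Set.toFinite _), ← Set.ncard_eq_toFinset_card]
  -- Without shelves there is one word for `n = 0` and none for `n > 0`.
  rcases Nat.eq_zero_or_pos m with rfl | hm
  · rcases n with _ | n
    · simp
    · have : (shelfPerm ⁻¹' E : Set (Fin (n + 1) → Fin 0 × Bool)) = ∅ :=
        Set.eq_empty_of_isEmpty _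
      simp [this]
  · rw [ENNReal.ofReal_div_of_pos (by positivity), ENNReal.ofReal_natCast, Fintype.card_fun,
      card_letters, Fintype.card_fin]
    congr 1
    rw [← ENNReal.ofReal_natCast]
    push_cast
    rfl

lemma isProbabilityMeasure_shelfShuffle (hm : 1 ≤ m) (n : ℕ) :
    IsProbabilityMeasure (shelfShuffle m n) := by
  have : Nonempty (Fin m × Bool) := ⟨(⟨0, hm⟩, true)⟩
  have : IsProbabilityMeasure (uniformOn (Set.univ : Set (Fin n → Fin m × Bool))) :=
    isProbabilityMeasure_uniformOn Set.finite_univ Set.univ_nonempty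
  exact Measure.isProbabilityMeasure_map .of_discrete

lemma shelfShuffle_cycleCount (n : ℕ) (S : Finset ℕ) (j : ℕ → ℕ) :
    shelfShuffle m n {w | ∀ i ∈ S, cycleCount i w = j i} =
      ENNReal.ofReal (wordCount (fun _ => shelfPerm (m := m)) S j n / (2 * m : ℝ) ^ n) := by
  rw [shelfShuffle_apply]
  rfl

lemma tendsto_shelfShuffle_cycleCount (hm : 1 ≤ m) {S : Finset ℕ} (hS : ∀ i ∈ S, 0 < i)
    (j : ℕ → ℕ) :
    Filter.Tendsto (fun n => shelfShuffle m n {w | ∀ i ∈ S, cycleCount i w = j i}) Filter.atTop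
      (nhds (∏ i ∈ S, cycleLaw (necklaceCount (shelfSign (m := m)) (-1) i)
        ((1 / (2 * m : ℝ)) ^ i) {j i})) := by
  have hm' : (1 : ℝ) ≤ m := by exact_mod_cast hm
  have hq0 : ∀ i, (0 : ℝ) ≤ (1 / (2 * m : ℝ)) ^ i := fun i => by positivity
  have hq1 : ∀ i ∈ S, (1 / (2 * m : ℝ)) ^ i < 1 := fun i hi =>
    pow_lt_one₀ (by positivity) (by rw [div_lt_one (by positivity)]; linarith) (hS i hi).ne'
  have h := tendsto_wordCount shelfRank_injective sum_shelfSign (fun _ => shelfPerm (m := m))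
    (fun _ ω => isSorting_shelfPerm ω) (by rw [card_letters]; omega) hS j
  have h2 := ENNReal.tendsto_ofReal h
  rw [ENNReal.ofReal_prod_of_nonneg (fun i hi => by
    rw [card_letters]; push_cast
    exact bernoulliGeometricMass_nonneg _ (hq0 i) (hq1 i hi) _)] at h2
  simp only [card_letters] at h2
  push_cast at h2
  simp only [shelfShuffle_cycleCount]
  rwa [Finset.prod_congr rfl fun i hi => cycleLaw_singleton _ (hq0 i) (hq1 i hi) (j i)]

lemma measurableSet_sigmaPerm (E : Set (Σ n : ℕ, Equiv.Perm (Fin n))) : MeasurableSet E :=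
  MeasurableSpace.measurableSet_iInf.2 fun _ => trivial

instance instDiscreteSigmaPerm : DiscreteMeasurableSpace (Σ n : ℕ, Equiv.Perm (Fin n)) :=
  ⟨measurableSet_sigmaPerm⟩

lemma randomDeckShuffle_apply {u : ℝ} (hu0 : 0 < u) (hu1 : u < 1)
    (E : Set (Σ n : ℕ, Equiv.Perm (Fin n))) :
    randomDeckShuffle m u E =
      ∑' n, ENNReal.ofReal ((1 - u) * u ^ n) * shelfShuffle m n ({w | (⟨n, w⟩ : Σ n : ℕ, Equiv.Perm (Fin n)) ∈ E}) := by
  have hp : (toProb (1 - u) : ℝ) = 1 - u := coe_toProb (by linarith) (by linarith)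
  have hp0 : toProb (1 - u) ≠ 0 := fun h => by
    rw [h] at hp
    have : (0 : ℝ) = 1 - u := hp
    linarith
  rw [randomDeckShuffle, Measure.bind_apply .of_discrete Measurable.of_discrete.aemeasurable,
    lintegral_countable']
  refine tsum_congr fun n => ?_
  rw [geometricMeasure_singleton hp0, hp, Measure.map_apply .of_discrete .of_discrete, mul_comm,
    sub_sub_cancel, mul_comm (u ^ n)]
  rfl

lemma randomDeckShuffle_cycleCount (hm : 1 ≤ m) {u : ℝ} (hu0 : 0 < u) (hu1 : u < 1)
    {S : Finset ℕ} (hS : ∀ i ∈ S, 0 < i) (j : ℕ → ℕ) :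
    randomDeckShuffle m u {W | ∀ i ∈ S, cycleCount i W.2 = j i} =
      ∏ i ∈ S, cycleLaw (necklaceCount (shelfSign (m := m)) (-1) i)
        ((u / (2 * m : ℝ)) ^ i) {j i} := by
  have hm' : (1 : ℝ) ≤ m := by exact_mod_cast hm
  have hq0 : ∀ i, (0 : ℝ) ≤ (u / (2 * m : ℝ)) ^ i := fun i => by positivity
  have hq1 : ∀ i ∈ S, (u / (2 * m : ℝ)) ^ i < 1 := fun i hi =>
    pow_lt_one₀ (by positivity) (by rw [div_lt_one (by positivity)]; linarith) (hS i hi).ne'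
  have h := hasSum_wordCount shelfRank_injective sum_shelfSign (fun _ => shelfPerm (m := m))
    (fun _ ω => isSorting_shelfPerm ω) (by rw [card_letters]; omega) hS j hu0 hu1
  rw [randomDeckShuffle_apply hu0 hu1,
    Finset.prod_congr rfl fun i hi => cycleLaw_singleton _ (hq0 i) (hq1 i hi) (j i),
    ← ENNReal.ofReal_prod_of_nonneg fun i hi =>
      bernoulliGeometricMass_nonneg _ (hq0 i) (hq1 i hi) _]
  have hu : 0 ≤ 1 - u := by linarith
  rw [card_letters] at h
  push_cast at h
  rw [← h.tsum_eq, ENNReal.ofReal_tsum_of_nonneg (fun n => by positivity) h.summable]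
  refine tsum_congr fun n => ?_
  rw [ENNReal.ofReal_mul (p := (1 - u) * u ^ n) (by positivity), ← shelfShuffle_cycleCount]
  rfl

lemma isProbabilityMeasure_randomDeckShuffle (hm : 1 ≤ m) {u : ℝ} (hu0 : 0 < u) (hu1 : u < 1) :
    IsProbabilityMeasure (randomDeckShuffle m u) := by
  -- For the empty set of lengths the event is everything and the product is `1`, which gives the
  -- total mass.
  have h := randomDeckShuffle_cycleCount hm hu0 hu1 (S := ∅) (by simp) (fun _ => 0)
  exact ⟨by simpa using h⟩

lemma map_cycleCount_randomDeckShuffle (hm : 1 ≤ m) {u : ℝ} (hu0 : 0 < u) (hu1 : u < 1) {i : ℕ}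
    (hi : 0 < i) :
    (randomDeckShuffle m u).map (fun W => cycleCount i W.2) =
      cycleLaw (necklaceCount (shelfSign (m := m)) (-1) i) ((u / (2 * m : ℝ)) ^ i) := by
  refine Measure.ext_iff_singleton.2 fun j => ?_
  have h := randomDeckShuffle_cycleCount hm hu0 hu1 (S := {i}) (by simpa using hi) (fun _ => j)
  rw [Measure.map_apply .of_discrete (measurableSet_singleton j)]
  simpa [Set.preimage] using h

end ShelfLaw

/-! ### Joint laws of finitely many cycle counts. -/

section JointLaws

variable {m : ℕ}

/-- The values of the cycle counts for a finite set of positive lengths, as an event about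
lengths in `ℕ`. -/
lemma cycleCounts_eq_iff {n : ℕ} (S : Finset ℕ+) (a : S → ℕ) (w : Equiv.Perm (Fin n)) :
    (fun i : S => cycleCount (i : ℕ+) w) = a ↔
      ∀ i ∈ S.map ⟨PNat.val, PNat.coe_injective⟩, cycleCount i w =
        if h : ∃ k : S, ((k : ℕ+) : ℕ) = i then a h.choose else 0 := by
  -- The value `0` is a default that is never met on lengths from `S`; there the chosen index is `k`
  -- itself by injectivity.
  have hval : ∀ k : S, (if h : ∃ k' : S, ((k' : ℕ+) : ℕ) = ((k : ℕ+) : ℕ) then a h.choose else 0) =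
      a k := fun k => by
    have h : ∃ k' : S, ((k' : ℕ+) : ℕ) = ((k : ℕ+) : ℕ) := ⟨k, rfl⟩
    rw [dif_pos h]
    congr 1
    exact Subtype.ext (PNat.coe_injective h.choose_spec)
  constructor
  · rintro rfl i hi
    obtain ⟨k, hk, rfl⟩ := Finset.mem_map.1 hi
    exact (hval ⟨k, hk⟩).symm
  · intro h
    funext k
    rw [← hval k]
    exact h _ (Finset.mem_map.2 ⟨k, k.2, rfl⟩)

lemma prod_map_pnat {M : Type*} [CommMonoid M] (S : Finset ℕ+) (a : S → ℕ) (F : ℕ → ℕ → M) :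
    ∏ i ∈ S.map ⟨PNat.val, PNat.coe_injective⟩,
      F i (if h : ∃ k : S, ((k : ℕ+) : ℕ) = i then a h.choose else 0) =
    ∏ k : S, F (k : ℕ+) (a k) := by
  rw [Finset.prod_map, ← Finset.prod_coe_sort]
  refine Finset.prod_congr rfl fun k _ => ?_
  have h : ∃ k' : S, ((k' : ℕ+) : ℕ) = ((k : ℕ+) : ℕ) := ⟨k, rfl⟩
  have h2 : h.choose = k := Subtype.ext (PNat.coe_injective h.choose_spec)
  simp only [Function.Embedding.coeFn_mk]
  rw [dif_pos h, h2]

/-- Independence is a matter of finite subfamilies. For each, the joint law and the product of the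
marginals have the same point masses, which determine a measure on a countable space. -/
lemma iIndepFun_cycleCount (hm : 1 ≤ m) {u : ℝ} (hu0 : 0 < u) (hu1 : u < 1) :
    iIndepFun (fun (i : ℕ+) (W : Σ n : ℕ, Equiv.Perm (Fin n)) => cycleCount i W.2)
      (randomDeckShuffle m u) := by
  have := isProbabilityMeasure_randomDeckShuffle hm hu0 hu1
  have hm' : (1 : ℝ) ≤ m := by exact_mod_cast hm
  have hlaw : ∀ i : ℕ+, IsProbabilityMeasure
      (cycleLaw (necklaceCount (shelfSign (m := m)) (-1) i) ((u / (2 * m : ℝ)) ^ (i : ℕ))) :=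
    fun i => isProbabilityMeasure_cycleLaw _ (by positivity)
      (pow_lt_one₀ (by positivity) (by rw [div_lt_one (by positivity)]; linarith) i.ne_zero)
  rw [iIndepFun_iff_finset]
  intro S
  rw [iIndepFun_iff_map_fun_eq_pi_map fun _ => Measurable.of_discrete.aemeasurable]
  refine Measure.ext_iff_singleton.2 fun a => ?_
  have hmap : ∀ i : S, (randomDeckShuffle m u).map (S.restrict
      (fun (i : ℕ+) (W : Σ n : ℕ, Equiv.Perm (Fin n)) => cycleCount i W.2) i) =
      cycleLaw (necklaceCount (shelfSign (m := m)) (-1) (i : ℕ+))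
        ((u / (2 * m : ℝ)) ^ ((i : ℕ+) : ℕ)) := fun i =>
    map_cycleCount_randomDeckShuffle hm hu0 hu1 (i : ℕ+).pos
  simp only [hmap]
  rw [Measure.pi_singleton, Measure.map_apply .of_discrete (measurableSet_singleton a)]
  have h := randomDeckShuffle_cycleCount hm hu0 hu1
    (S := S.map ⟨PNat.val, PNat.coe_injective⟩)
    (fun i hi => by obtain ⟨k, -, rfl⟩ := Finset.mem_map.1 hi; exact k.pos)
    (fun i => if h : ∃ k : S, ((k : ℕ+) : ℕ) = i then a h.choose else 0)
  rw [prod_map_pnat S a fun i j => cycleLaw (necklaceCount (shelfSign (m := m)) (-1) i)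
    ((u / (2 * m : ℝ)) ^ i) {j}] at h
  rw [← h]
  congr 1
  ext W
  exact cycleCounts_eq_iff S a W.2

lemma tendsto_shelfShuffle_joint (hm : 1 ≤ m) (S : Finset ℕ+) (A : Set (S → ℕ)) :
    Filter.Tendsto
      (fun n : ℕ => shelfShuffle m n {w | (fun i : S => cycleCount (i : ℕ+) w) ∈ A})
      Filter.atTop
      (nhds (Measure.pi (fun i : S => cycleLaw (necklaceCount (shelfSign (m := m)) (-1) (i : ℕ+))
        ((1 / (2 * m : ℝ)) ^ ((i : ℕ+) : ℕ))) A)) := by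
  have hm' : (1 : ℝ) ≤ m := by exact_mod_cast hm
  have hlaw : ∀ i : ℕ+, IsProbabilityMeasure
      (cycleLaw (necklaceCount (shelfSign (m := m)) (-1) i) ((1 / (2 * m : ℝ)) ^ (i : ℕ))) :=
    fun i => isProbabilityMeasure_cycleLaw _ (by positivity)
      (pow_lt_one₀ (by positivity) (by rw [div_lt_one (by positivity)]; linarith) i.ne_zero)
  let ν : ℕ → Measure (S → ℕ) := fun n =>
    (shelfShuffle m n).map fun w => fun i : S => cycleCount (i : ℕ+) w
  have hν : ∀ n, IsProbabilityMeasure (ν n) := fun n => by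
    have := isProbabilityMeasure_shelfShuffle hm n
    exact Measure.isProbabilityMeasure_map Measurable.of_discrete.aemeasurable
  have hνA : ∀ n B, ν n B = shelfShuffle m n {w | (fun i : S => cycleCount (i : ℕ+) w) ∈ B} :=
    fun n B => Measure.map_apply .of_discrete .of_discrete
  simp only [← hνA]
  refine tendsto_measure_of_tendsto_singleton (fun a => ?_) A
  have h := tendsto_shelfShuffle_cycleCount hm
    (S := S.map ⟨PNat.val, PNat.coe_injective⟩)
    (fun i hi => by obtain ⟨k, -, rfl⟩ := Finset.mem_map.1 hi; exact k.pos)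
    (fun i => if h : ∃ k : S, ((k : ℕ+) : ℕ) = i then a h.choose else 0)
  rw [prod_map_pnat S a fun i j => cycleLaw (necklaceCount (shelfSign (m := m)) (-1) i)
    ((1 / (2 * m : ℝ)) ^ i) {j}] at h
  rw [Measure.pi_singleton]
  simp only [hνA, Set.mem_singleton_iff, cycleCounts_eq_iff]
  exact h

end JointLaws

end ShelfShuffle

theorem corollary3p1 (m : ℕ) (hm : 1 ≤ m) :
    ∃ f : ℕ+ → ℕ, (∀ i : ℕ+, (f i : ℚ) = cycleExponent i m) ∧
      -- a geometric number of cards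
      (∀ u : ℝ, 0 < u → u < 1 →
        iIndepFun (fun (i : ℕ+) (W : Σ n : ℕ, Equiv.Perm (Fin n)) => cycleCount i W.2)
          (randomDeckShuffle m u) ∧
        ∀ i : ℕ+,
          (randomDeckShuffle m u).map (fun W => cycleCount i W.2) =
            Measure.conv
              (binomial (f i)
                (toProb ((u / (2 * m)) ^ (i : ℕ) / (1 + (u / (2 * m)) ^ (i : ℕ)))))
              (negativeBinomial (f i) (toProb ((u / (2 * m)) ^ (i : ℕ))))) ∧
      -- the number of cards tends to infinity
      (∀ (S : Finset ℕ+) (A : Set (S → ℕ)),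
        Filter.Tendsto
          (fun n : ℕ => shelfShuffle m n {w | (fun i : S => cycleCount (i : ℕ+) w) ∈ A})
          Filter.atTop
          (nhds
            (Measure.pi
              (fun i : S =>
                Measure.conv
                  (binomial (f i) (toProb (1 / ((2 * m) ^ ((i : ℕ+) : ℕ) + 1))))
                  (negativeBinomial (f i) (toProb ((1 / (2 * m)) ^ ((i : ℕ+) : ℕ)))))
              A))) := by
  -- The exponent is the number of necklaces of length `i` with an odd number of bottom letters,
  -- hence a natural number.
  refine ⟨fun i => necklaceCount (shelfSign (m := m)) (-1) i,
    fun i => necklaceCount_eq_cycleExponent i.pos, fun u hu0 hu1 =>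
      ⟨iIndepFun_cycleCount hm hu0 hu1, fun i =>
        map_cycleCount_randomDeckShuffle hm hu0 hu1 i.pos⟩, fun S A => ?_⟩
  have h := tendsto_shelfShuffle_joint hm S A
  have hm' : (m : ℝ) ≠ 0 := by exact_mod_cast (by omega : m ≠ 0)
  -- The limiting binomial parameter is `q / (1 + q)` with `q = (1 / 2m)^i`.
  have hq : ∀ i : ℕ, (1 / (2 * m : ℝ)) ^ i / (1 + (1 / (2 * m : ℝ)) ^ i) =
      1 / ((2 * m : ℝ) ^ i + 1) := fun i => by
    rw [one_div, inv_pow]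
    field_simp
  simpa only [cycleLaw, hq] using h
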